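/- Let $N\ge 1$ and let a chord diagram be given: $2N$ distinct points $a_1,\dots,a_{2N}$ on the unit circle, numbered in counterclockwise cyclic order, joined in disjoint pairs by $N$ straight chords. Let $c$ be the number of points of the plane lying on at least two different chords (the intersection points). Call a finite set $P$ of points an *admissible set of interior points* if every point of $P$ lies on some chord, in its relative interior, and $P$ contains all intersection points. Given such a $P$ and a set $S$ of arcs of the circle between cyclically consecutive points $a_i,a_{i+1}$ (for example no arcs, or all $2N$ arcs), let $G=G(P,S)$ be the plane (multi)graph whose vertices are $a_1,\dots,a_{2N}$ and the points of $P$, and whose edges are the pieces of chords between consecutive vertices together with the arcs in $S$. For a set $U$ of vertices let $M(G\setminus U)$ be the number of perfect matchings of the graph obtained by deleting $U$, and let $A=A(P,S)=(a_{ij})$ be the skew-symmetric $2N\times 2N$ matrix with $$a_{ij}=M(G\setminus\{a_i,a_j\})\ (i<j),\qquad a_{ij}=-M(G\setminus\{a_i,a_j\})\ (i>j),\qquad a_{ii}=0 .$$ Then: (1) There is an admissible set $P$ of interior points with an even number of elements. More precisely, it can be chosen to consist of the $c$ intersection points and of $2$ further points if $c=0$, no further point if $c>0$ is even, and one further point if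 $c$ is odd. (2) For every admissible set $P$ with an even number of elements and every $S$, the matrix $A(P,S)$ is a totally non-negative Pfaffian (TNNP): it is a real skew-symmetric matrix, and each of its principal submatrices of even size $2m$, $0\le m\le N$, has a non-negative Pfaffian (the Pfaffian of the empty matrix being $1$). -/

import Mathlib

noncomputable section

namespace ChordTNNP

/-! ### Pfaffians and totally non-negative Pfaffian matrices -/

/-- The permutations `σ` of `{0, …, 2m-1}` with `σ 0 < σ 2 < σ 4 < ⋯` and
`σ 0 < σ 1`, `σ 2 < σ 3`, …; they index the terms of the Pfaffian. -/
def IsPfaffianPerm {m : ℕ} (σ : Equiv.Perm (Fin (2 * m))) : Prop :=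
  (∀ i : Fin m, σ ⟨2 * i, by omega⟩ < σ ⟨2 * i + 1, by omega⟩) ∧
    ∀ i j : Fin m, i < j → σ ⟨2 * i, by omega⟩ < σ ⟨2 * j, by omega⟩

open Classical in
/-- The Pfaffian of a `2m × 2m` matrix (it only reads the entries above the diagonal).
For `m = 0` it is `1`. -/
def pfaffian {m : ℕ} (A : Matrix (Fin (2 * m)) (Fin (2 * m)) ℝ) : ℝ :=
  ∑ σ : Equiv.Perm (Fin (2 * m)) with IsPfaffianPerm σ,
    ((Equiv.Perm.sign σ : ℤ) : ℝ) *
      ∏ i : Fin m, A (σ ⟨2 * i, by omega⟩) (σ ⟨2 * i + 1, by omega⟩)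

/-- A totally non-negative Pfaffian: a real skew-symmetric `2n × 2n` matrix all of whose
principal submatrices of even size `2m` have a non-negative Pfaffian. A principal submatrix is
given by the increasing enumeration `f` of the chosen rows. -/
structure IsTNNP {n : ℕ} (A : Matrix (Fin (2 * n)) (Fin (2 * n)) ℝ) : Prop where
  skew : A.transpose = -A
  nonneg : ∀ (m : ℕ) (f : Fin (2 * m) ↪o Fin (2 * n)), 0 ≤ pfaffian (A.submatrix f f)

/-! ### Perfect matchings of multigraphs -/

/-- A set `M` of edges of `G` such that each vertex of `G` is incident with exactly one edge
of `M`. -/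
def IsPerfectMatching {α β : Type*} (G : Graph α β) (M : Set β) : Prop :=
  M ⊆ G.edgeSet ∧ ∀ v ∈ G.vertexSet, ∃! e, e ∈ M ∧ G.Inc e v

/-- The number `M(G)` of perfect matchings (it is only used for finite graphs). -/
def matchingCount {α β : Type*} (G : Graph α β) : ℕ :=
  {M : Set β | IsPerfectMatching G M}.ncard

/-! ### Chord diagrams -/

/-- A chord diagram of `N` chords: `2N` points on the unit circle of the plane `ℂ`, numbered
counterclockwise (`angle i` is the argument of the `i`-th point), and a fixed-point-free
involution `mate` which sends each point to the other end of its chord. -/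
structure ChordDiagram (N : ℕ) where
  angle : Fin (2 * N) → ℝ
  angle_strictMono : StrictMono angle
  angle_lt : ∀ i j, angle i < angle j + 2 * Real.pi
  mate : Fin (2 * N) → Fin (2 * N)
  mate_mate : ∀ i, mate (mate i) = i
  mate_ne : ∀ i, mate i ≠ i

namespace ChordDiagram

variable {N : ℕ} (D : ChordDiagram N)

/-- The `i`-th boundary point. -/
def pt (i : Fin (2 * N)) : ℂ := (Circle.exp (D.angle i) : ℂ)

/-- The chord through the `i`-th boundary point, ends included. -/
def chord (i : Fin (2 * N)) : Set ℂ := segment ℝ (D.pt i) (D.pt (D.mate i))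

/-- The chord through the `i`-th boundary point without its two ends. -/
def openChord (i : Fin (2 * N)) : Set ℂ := openSegment ℝ (D.pt i) (D.pt (D.mate i))

/-- The intersection points: the points that lie on two different chords. -/
def crossings : Set ℂ :=
  {z | ∃ i j, j ≠ i ∧ j ≠ D.mate i ∧ z ∈ D.chord i ∧ z ∈ D.chord j}

/-- `P` is an admissible set of interior points: all its points lie on chords, away from the
boundary points, and every intersection point belongs to it. -/
def IsInterior (P : Finset ℂ) : Prop :=
  (∀ z ∈ P, ∃ i, z ∈ D.openChord i) ∧ D.crossings ⊆ (P : Set ℂ)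

/-- The vertices of the plane graph: the boundary points and the interior points. -/
def vertices (P : Finset ℂ) : Set ℂ := Set.range D.pt ∪ (P : Set ℂ)

/-- `u` and `v` are consecutive vertices on a chord. -/
def Consecutive (P : Finset ℂ) (u v : ℂ) : Prop :=
  u ≠ v ∧ u ∈ D.vertices P ∧ v ∈ D.vertices P ∧ (∃ i, u ∈ D.chord i ∧ v ∈ D.chord i) ∧
    Disjoint (openSegment ℝ u v) (D.vertices P)

/-- Incidence in the plane graph. An edge is either a piece of a chord between two consecutive
vertices `u`, `v`, labelled `Sum.inl s(u, v)`, or, for `i ∈ S`, the arc of the circle from the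
`i`-th boundary point to the cyclically next one, labelled `Sum.inr i`. -/
def Link (P : Finset ℂ) (S : Set (Fin (2 * N))) :
    Sym2 ℂ ⊕ Fin (2 * N) → ℂ → ℂ → Prop
  | Sum.inl e, u, v => e = s(u, v) ∧ D.Consecutive P u v
  | Sum.inr i, u, v => i ∈ S ∧ s(u, v) = s(D.pt i, D.pt (finRotate (2 * N) i))

lemma Consecutive.symm {P : Finset ℂ} {u v : ℂ} (h : D.Consecutive P u v) :
    D.Consecutive P v u := by
  obtain ⟨h1, h2, h3, ⟨i, h4, h5⟩, h6⟩ := h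
  exact ⟨h1.symm, h3, h2, ⟨i, h5, h4⟩, by rwa [openSegment_symm]⟩

/-- The plane graph of the chord diagram `D` with interior points `P` and with those arcs of the
circle whose index lies in `S`. It is a multigraph: an arc may be parallel to an undivided
chord. -/
def planeGraph (P : Finset ℂ) (S : Set (Fin (2 * N))) : Graph ℂ (Sym2 ℂ ⊕ Fin (2 * N)) where
  vertexSet := D.vertices P
  IsLink := D.Link P S
  isLink_symm := by
    rintro (e | i) -
    · exact ⟨fun u v h => ⟨h.1.trans Sym2.eq_swap, h.2.symm⟩⟩
    · exact ⟨fun u v h => ⟨h.1, Sym2.eq_swap.trans h.2⟩⟩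
  eq_or_eq_of_isLink_of_isLink := by
    rintro (e | i) x y v w h h'
    · have h0 : s(x, y) = s(v, w) := h.1.symm.trans h'.1
      rcases Sym2.eq_iff.1 h0 with h1 | h1
      · exact Or.inl h1.1
      · exact Or.inr h1.1
    · have h0 : s(x, y) = s(v, w) := h.2.trans h'.2.symm
      rcases Sym2.eq_iff.1 h0 with h1 | h1
      · exact Or.inl h1.1
      · exact Or.inr h1.1
  left_mem_of_isLink := by
    rintro (e | i) x y h
    · exact h.2.2.1
    · rcases Sym2.eq_iff.1 h.2 with h1 | h1
      · exact Or.inl ⟨i, h1.1.symm⟩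
      · exact Or.inl ⟨finRotate (2 * N) i, h1.1.symm⟩

/-- The skew-symmetric matrix with entries `M(G \ {a_i, a_j})` above the diagonal, where `G` is
the plane graph and `a_i` is the `i`-th boundary point. -/
def matchingMatrix (P : Finset ℂ) (S : Set (Fin (2 * N))) :
    Matrix (Fin (2 * N)) (Fin (2 * N)) ℝ :=
  Matrix.of fun i j =>
    if i < j then (matchingCount ((D.planeGraph P S).deleteVerts {D.pt i, D.pt j}) : ℝ)
    else if j < i then -(matchingCount ((D.planeGraph P S).deleteVerts {D.pt i, D.pt j}) : ℝ)
    else 0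

end ChordDiagram

end ChordTNNP

end

noncomputable section

namespace ChordTNNP

/-! ### Expansion of the Pfaffian along its first row -/

/-! The heart of the matter is a closed formula. Let `T` be a set of `2 (m + 1)` boundary points.
The Pfaffian of the corresponding principal submatrix is `M(G) ^ m * M(G \ T)`, which is visibly
non-negative (`pfaffian_matchingMatrix`). It follows by induction on `m` from two expansions of the
same shape: that of the Pfaffian along its first row (`pfaffian_succ`) and that of `M(G) * M(G \ T)`
along the first point of `T` (`matchingCount_mul_matchingCount`).

The second expansion is a case of Kuo-type condensation (`sum_matchingCount_mul_eq_zero`). Superpose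
two matchings that together miss each point of `T` exactly once. The components meeting `T` are
paths that pair the points of `T`. Exchanging the two matchings along the path from the
distinguished point `j` moves the distinction to its partner. By planarity the pairing is
non-crossing, so partners have opposite parity, and the exchange is a sign-reversing involution.

Planarity enters only through `joined_of_interleaved`: walks whose ends interleave on the circle
meet. No Jordan curve theorem is used. If the walks were disjoint, logarithms added up along the
first would give a continuous logarithm of `(b - z) / (a - z)`, up to a constant factor, on the
chord pieces of the second. Comparing it with an explicit logarithm in the disc shows that both ends
of the second walk are on the same side of `a` and `b` in the cyclic order.

The existence of `P` is a counting matter: finitely many crossings lie in an infinite union of open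
chords, so admissible sets of every larger size exist. -/

/-- The permutation of `Fin (n + 1)` with first value `p` whose remaining values are ordered
as those of `e`. -/
def consPerm {n : ℕ} (p : Fin (n + 1)) (e : Equiv.Perm (Fin n)) : Equiv.Perm (Fin (n + 1)) :=
  p.cycleRange.symm * Equiv.Perm.decomposeFin.symm (0, e)

lemma consPerm_zero {n : ℕ} (p : Fin (n + 1)) (e : Equiv.Perm (Fin n)) : consPerm p e 0 = p := by
  simp [consPerm]

lemma consPerm_succ {n : ℕ} (p : Fin (n + 1)) (e : Equiv.Perm (Fin n)) (x : Fin n) :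
    consPerm p e x.succ = p.succAbove (e x) := by
  simp [consPerm]

/-- The extra factor is the sign of the cycle that brings `p` to the front. -/
lemma sign_consPerm {n : ℕ} (p : Fin (n + 1)) (e : Equiv.Perm (Fin n)) :
    Equiv.Perm.sign (consPerm p e) = (-1) ^ (p : ℕ) * Equiv.Perm.sign e := by
  rw [consPerm, Equiv.Perm.sign_mul, Equiv.Perm.sign_symm, Fin.sign_cycleRange,
    Equiv.Perm.decomposeFin.symm_sign]
  simp

lemma consPerm_injective {n : ℕ} {p q : Fin (n + 1)} {e f : Equiv.Perm (Fin n)}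
    (h : consPerm p e = consPerm q f) : p = q ∧ e = f := by
  have hp : p = q := by rw [← consPerm_zero p e, h, consPerm_zero]
  subst hp
  refine ⟨rfl, Equiv.ext fun x => ?_⟩
  have := congrArg (fun s : Equiv.Perm (Fin (n + 1)) => s x.succ) h
  simpa only [consPerm_succ, Fin.succAbove_right_inj] using this

lemma exists_consPerm_eq {n : ℕ} (s : Equiv.Perm (Fin (n + 1))) :
    ∃ e, consPerm (s 0) e = s := by
  obtain ⟨⟨p, e⟩, h⟩ := Equiv.Perm.decomposeFin.symm.surjective ((s 0).cycleRange * s)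
  have h0 : p = 0 := by
    have := congrArg (fun t : Equiv.Perm (Fin (n + 1)) => t 0) h
    simpa using this
  subst h0
  refine ⟨e, ?_⟩
  rw [consPerm, h]
  ext x
  simp

/-- The increasing enumeration of the indices different from `0` and `j + 1`. -/
def skipPair {m : ℕ} (j : Fin (2 * m + 1)) : Fin (2 * m) ↪o Fin (2 * (m + 1)) :=
  (Fin.succAboveOrderEmb j).trans (Fin.succOrderEmb (2 * m + 1))

/-- The permutation with values `0`, `j + 1`, followed by the remaining values in the order
given by `s`. -/
def consPair {m : ℕ} (j : Fin (2 * m + 1)) (s : Equiv.Perm (Fin (2 * m))) :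
    Equiv.Perm (Fin (2 * (m + 1))) :=
  consPerm (n := 2 * m + 1) 0 (consPerm j s)

lemma consPair_zero {m : ℕ} (j : Fin (2 * m + 1)) (s : Equiv.Perm (Fin (2 * m)))
    (h : 0 < 2 * (m + 1)) : consPair j s ⟨0, h⟩ = ⟨0, h⟩ :=
  consPerm_zero (n := 2 * m + 1) 0 (consPerm j s)

lemma consPair_one {m : ℕ} (j : Fin (2 * m + 1)) (s : Equiv.Perm (Fin (2 * m)))
    (h : 1 < 2 * (m + 1)) : consPair j s ⟨1, h⟩ = j.succ := by
  refine (consPerm_succ (n := 2 * m + 1) 0 (consPerm j s) 0).trans ?_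
  rw [consPerm_zero]
  rfl

lemma consPair_add_two {m : ℕ} (j : Fin (2 * m + 1)) (s : Equiv.Perm (Fin (2 * m))) (k : ℕ)
    (h : k + 2 < 2 * (m + 1)) : consPair j s ⟨k + 2, h⟩ = skipPair j (s ⟨k, by omega⟩) := by
  refine (consPerm_succ (n := 2 * m + 1) 0 (consPerm j s) ⟨k + 1, by omega⟩).trans ?_
  have : consPerm j s ⟨k + 1, by omega⟩ = j.succAbove (s ⟨k, by omega⟩) :=
    consPerm_succ j s ⟨k, by omega⟩
  rw [this, Fin.zero_succAbove]
  rfl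

/-- The new first pair starts with the least value, and `skipPair j` is increasing, so no order
condition on the later pairs is gained or lost. -/
lemma isPfaffianPerm_consPair {m : ℕ} (j : Fin (2 * m + 1)) (s : Equiv.Perm (Fin (2 * m))) :
    IsPfaffianPerm (consPair j s) ↔ IsPfaffianPerm s := by
  have e0 (i : Fin m) (h) : consPair j s ⟨2 * (i.succ : Fin (m + 1)), h⟩ =
      skipPair j (s ⟨2 * i, by omega⟩) := consPair_add_two j s (2 * i) (by omega)
  have e1 (i : Fin m) (h) : consPair j s ⟨2 * (i.succ : Fin (m + 1)) + 1, h⟩ =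
      skipPair j (s ⟨2 * i + 1, by omega⟩) := consPair_add_two j s (2 * i + 1) (by omega)
  constructor
  · rintro ⟨h1, h2⟩
    refine ⟨fun i => ?_, fun i k hik => ?_⟩
    · have := h1 i.succ
      rwa [e0, e1, OrderEmbedding.lt_iff_lt] at this
    · have := h2 i.succ k.succ (Fin.succ_lt_succ_iff.2 hik)
      rwa [e0, e0, OrderEmbedding.lt_iff_lt] at this
  · rintro ⟨h1, h2⟩
    have z0 (h) : consPair j s ⟨2 * ((0 : Fin (m + 1)) : ℕ), h⟩ = ⟨0, h⟩ := consPair_zero j s _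
    refine ⟨fun i => ?_, fun i k hik => ?_⟩
    · refine Fin.cases ?_ (fun i => ?_) i
      · rw [z0]
        have : consPair j s ⟨2 * ((0 : Fin (m + 1)) : ℕ) + 1, by simp; omega⟩ = j.succ :=
          consPair_one j s (by omega)
        rw [this]
        exact Fin.succ_pos j
      · rw [e0, e1, OrderEmbedding.lt_iff_lt]
        exact h1 i
    · obtain ⟨k, rfl⟩ := Fin.exists_succ_eq.2 (Fin.ne_zero_of_lt hik)
      rw [e0]
      induction i using Fin.cases with
      | zero =>
        rw [z0]
        exact Fin.succ_pos _
      | succ i =>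
        rw [e0, OrderEmbedding.lt_iff_lt]
        exact h2 i k (Fin.succ_lt_succ_iff.1 hik)

/-- The value at `0` is at most every value in even position, and each of these is below its
successor in odd position; so it is the minimum. -/
lemma IsPfaffianPerm.apply_zero {m : ℕ} {s : Equiv.Perm (Fin (2 * (m + 1)))}
    (hs : IsPfaffianPerm s) : s ⟨0, by omega⟩ = ⟨0, by omega⟩ := by
  have lt (i : Fin (m + 1)) : 2 * (i : ℕ) < 2 * (m + 1) := Nat.mul_lt_mul_of_pos_left i.2 two_pos
  have h0 (i : Fin (m + 1)) : s ⟨0, by omega⟩ ≤ s ⟨2 * i, lt i⟩ := by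
    rcases eq_or_ne i 0 with rfl | hi
    · exact le_rfl
    · exact (hs.2 0 i (Fin.pos_iff_ne_zero.2 hi)).le
  obtain ⟨⟨k, hk⟩, hx⟩ := s.surjective ⟨0, by omega⟩
  have hle : s ⟨0, by omega⟩ ≤ s ⟨k, hk⟩ := by
    rcases Nat.even_or_odd' k with ⟨i, rfl | rfl⟩
    · exact h0 ⟨i, by omega⟩
    · exact (h0 ⟨i, by omega⟩).trans (hs.1 ⟨i, by omega⟩).le
  rw [hx] at hle
  exact le_antisymm hle (Fin.mk_le_of_le_val (Nat.zero_le _))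

open Classical in
lemma pfaffian_zero (A : Matrix (Fin (2 * 0)) (Fin (2 * 0)) ℝ) :
    pfaffian A = 1 := by
  have : Subsingleton (Equiv.Perm (Fin (2 * 0))) :=
    inferInstanceAs (Subsingleton (Equiv.Perm (Fin 0)))
  have : Finset.univ.filter (IsPfaffianPerm (m := 0)) = {1} := by
    ext s
    simp [IsPfaffianPerm, Subsingleton.elim s 1]
  rw [pfaffian]
  convert Finset.sum_singleton _ (1 : Equiv.Perm (Fin (2 * 0)))
  simp

open Classical in
/-- Expansion of the Pfaffian along the first row. -/
theorem pfaffian_succ {m : ℕ} (A : Matrix (Fin (2 * (m + 1))) (Fin (2 * (m + 1))) ℝ) :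
    pfaffian A = ∑ j : Fin (2 * m + 1), (-1) ^ (j : ℕ) * A ⟨0, by omega⟩ j.succ *
      pfaffian (A.submatrix (skipPair j) (skipPair j)) := by
  simp only [pfaffian, Finset.mul_sum]
  rw [← Finset.sum_product' (f := fun (j : Fin (2 * m + 1)) (s : Equiv.Perm (Fin (2 * m))) =>
    (-1) ^ (j : ℕ) * A ⟨0, by omega⟩ j.succ * (((Equiv.Perm.sign s : ℤ) : ℝ) *
      ∏ i : Fin m, A.submatrix (skipPair j) (skipPair j) (s ⟨2 * i, by omega⟩)
        (s ⟨2 * i + 1, by omega⟩)))]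
  symm
  refine Finset.sum_bij (fun x _ => consPair x.1 x.2) ?_ ?_ ?_ ?_
  · rintro ⟨j, s⟩ h
    simpa [isPfaffianPerm_consPair] using h
  · rintro ⟨j, s⟩ - ⟨k, t⟩ - h
    obtain ⟨rfl, rfl⟩ := consPerm_injective (consPerm_injective h).2
    rfl
  · intro s hs
    have hs : IsPfaffianPerm s := by simpa using hs
    obtain ⟨e, he⟩ := exists_consPerm_eq (n := 2 * m + 1) s
    have h0 := hs.apply_zero
    obtain ⟨t, ht⟩ := exists_consPerm_eq e
    have hst : consPair (e 0) t = s := by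
      rw [consPair, ht, ← he]
      congr 1
      exact h0.symm
    refine ⟨(e 0, t), ?_, hst⟩
    simpa [← isPfaffianPerm_consPair (e 0), hst] using hs
  · rintro ⟨j, s⟩ -
    have hsign : Equiv.Perm.sign (consPair j s) = (-1) ^ (j : ℕ) * Equiv.Perm.sign s := by
      refine (sign_consPerm (n := 2 * m + 1) 0 (consPerm j s)).trans ?_
      rw [sign_consPerm]
      simp
    rw [Fin.prod_univ_succ, hsign]
    have e0 (i : Fin m) (h) : consPair j s ⟨2 * (i.succ : Fin (m + 1)), h⟩ =
      skipPair j (s ⟨2 * i, by omega⟩) := consPair_add_two j s (2 * i) (by omega)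
    have e1 (i : Fin m) (h) : consPair j s ⟨2 * (i.succ : Fin (m + 1)) + 1, h⟩ =
      skipPair j (s ⟨2 * i + 1, by omega⟩) := consPair_add_two j s (2 * i + 1) (by omega)
    have z0 (h) : consPair j s ⟨2 * ((0 : Fin (m + 1)) : ℕ), h⟩ = ⟨0, h⟩ := consPair_zero j s _
    have z1 (h) : consPair j s ⟨2 * ((0 : Fin (m + 1)) : ℕ) + 1, h⟩ = j.succ := consPair_one j s _
    simp only [e0, e1, z0, z1, Matrix.submatrix_apply]
    push_cast
    ring

end ChordTNNP
end

noncomputable section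

namespace ChordTNNP

/-! ### Pairs of involutions -/

/-- Two vertices are adjacent if one of the maps `f`, `g` exchanges them. -/
def pairGraph {V : Type*} (f g : V → V) : SimpleGraph V :=
  SimpleGraph.fromRel fun u v => v = f u ∨ v = g u

open Classical in
lemma even_card_fixed {V : Type*} [Fintype V] {f : V → V} (hf : Function.Involutive f) :
    (Finset.univ.filter fun v => f v = v).card % 2 = Fintype.card V % 2 := by
  have h : ∑ v ∈ Finset.univ.filter (fun v => ¬ f v = v), (1 : ZMod 2) = 0 := by
    refine Finset.sum_involution (fun v _ => f v) (fun v _ => ?_) (fun v hv _ => ?_)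
      (fun v hv => ?_) (fun v _ => hf v)
    · decide
    · simpa using hv
    · simpa [hf v, eq_comm] using hv
  rw [Finset.sum_const, nsmul_one, ZMod.natCast_eq_zero_iff] at h
  have := Finset.card_filter_add_card_filter_not (s := (Finset.univ : Finset V)) (fun v => f v = v)
  rw [Finset.card_univ] at this
  omega

open Classical in
/-- Two involutions that act connectedly on a finite set have at most two fixed points in total,
and an even number of them. -/
lemma card_fixed_eq_two {V : Type*} [Fintype V] {f g : V → V} (hf : Function.Involutive f)
    (hg : Function.Involutive g) (hfg : ∀ v, f v = v → g v ≠ v)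
    (hc : (pairGraph f g).Connected) {x : V} (hx : f x = x ∨ g x = x) :
    {v | f v = v ∨ g v = v}.ncard = 2 := by
  rw [Set.ncard_eq_toFinset_card', Set.toFinset_ofPred]
  set T := Finset.univ.filter fun v => f v = v ∨ g v = v with hT
  -- The neighbours of `v` are among `f v` and `g v`, and a fixed point of one of the maps loses one
  -- of these.
  have hdeg (v : V) : (pairGraph f g).degree v + (if f v = v ∨ g v = v then 1 else 0) ≤ 2 := by
    have hsub : (pairGraph f g).neighborFinset v ⊆ ({f v, g v} : Finset V).erase v := by
      intro w hw
      rw [SimpleGraph.mem_neighborFinset, pairGraph, SimpleGraph.fromRel_adj] at hw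
      obtain ⟨hne, (h | h) | (h | h)⟩ := hw
      · simp [← h, hne.symm]
      · simp [← h, hne.symm]
      · have : w = f v := by rw [h, hf]
        simp [← this, hne.symm]
      · have : w = g v := by rw [h, hg]
        simp [← this, hne.symm]
    have hcard := Finset.card_le_card hsub
    rw [SimpleGraph.card_neighborFinset_eq_degree] at hcard
    split_ifs with h
    · have : v ∈ ({f v, g v} : Finset V) := by
        rcases h with h | h <;> simp [h]
      have h2 : ({f v, g v} : Finset V).card ≤ 2 := Finset.card_le_two
      have := Finset.card_erase_of_mem this
      omega
    · have h2 : ({f v, g v} : Finset V).card ≤ 2 := Finset.card_le_two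
      have := Finset.card_erase_le (s := ({f v, g v} : Finset V)) (a := v)
      omega
  have hsum := Finset.sum_le_sum fun v (_ : v ∈ Finset.univ) => hdeg v
  rw [Finset.sum_add_distrib, SimpleGraph.sum_degrees_eq_twice_card_edges, Finset.sum_boole,
    Finset.sum_const, Finset.card_univ, smul_eq_mul, ← hT, Nat.cast_id] at hsum
  -- A connected graph has at least `|V| - 1` edges, so the degree sum leaves room for at most two
  -- fixed points.
  have hedge := hc.card_vert_le_card_edgeSet_add_one
  rw [Nat.card_eq_fintype_card, Nat.card_eq_fintype_card, ← SimpleGraph.edgeFinset_card] at hedge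
  have hpos : 0 < T.card := Finset.card_pos.2 ⟨x, by simp [hT, hx]⟩
  have hodd : T.card = (Finset.univ.filter fun v => f v = v).card +
      (Finset.univ.filter fun v => g v = v).card := by
    rw [hT, Finset.filter_or, Finset.card_union_of_disjoint]
    rw [Finset.disjoint_filter]
    exact fun v _ => hfg v
  -- Both numbers of fixed points have the parity of `|V|`. Their sum is therefore even, and being
  -- positive and at most `2` it is `2`.
  have := even_card_fixed hf
  have := even_card_fixed hg
  omega

/-! ### Superposition of matchings -/

section Graph

variable {α β : Type*} {G : Graph α β}

/-- A perfect matching of the graph obtained from `G` by deleting the vertices in `U`. -/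
structure IsMatchingOff (G : Graph α β) (U : Set α) (M : Set β) : Prop where
  subset : M ⊆ G.edgeSet
  existsUnique : ∀ v ∈ G.vertexSet, v ∉ U → ∃! e, e ∈ M ∧ G.Inc e v
  not_inc : ∀ e ∈ M, ∀ v ∈ U, ¬ G.Inc e v

lemma isPerfectMatching_deleteVerts {U : Set α} {M : Set β} :
    IsPerfectMatching (G.deleteVerts U) M ↔ IsMatchingOff G U M := by
  constructor
  · rintro ⟨h1, h2⟩
    have key : ∀ e ∈ M, ∀ v ∈ U, ¬ G.Inc e v := by
      rintro e he v hv hinc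
      have := h1 he
      rw [Graph.edgeSet_deleteVerts] at this
      obtain ⟨x, y, hxy, hx, hy⟩ := this
      rcases hinc.eq_or_eq_of_isLink hxy with rfl | rfl <;> contradiction
    refine ⟨fun e he => ?_, fun v hv hvU => ?_, key⟩
    · have := h1 he
      rw [Graph.edgeSet_deleteVerts] at this
      obtain ⟨x, y, hxy, -⟩ := this
      exact hxy.edge_mem
    · obtain ⟨e, ⟨he, y, hinc⟩, huniq⟩ := h2 v ⟨hv, hvU⟩
      rw [Graph.deleteVerts_isLink] at hinc
      refine ⟨e, ⟨he, y, hinc.1⟩, ?_⟩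
      rintro e' ⟨he', y', hinc'⟩
      refine huniq e' ⟨he', y', ?_⟩
      rw [Graph.deleteVerts_isLink]
      exact ⟨hinc', hvU, fun hy => key e' he' y' hy hinc'.inc_right⟩
  · rintro ⟨h1, h2, h3⟩
    refine ⟨fun e he => ?_, fun v hv => ?_⟩
    · obtain ⟨x, y, hxy⟩ := Graph.exists_isLink_of_mem_edgeSet (h1 he)
      rw [Graph.edgeSet_deleteVerts]
      exact ⟨x, y, hxy, fun hx => h3 e he x hx hxy.inc_left,
        fun hy => h3 e he y hy hxy.inc_right⟩
    · rw [Graph.vertexSet_deleteVerts] at hv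
      obtain ⟨e, ⟨he, y, hinc⟩, huniq⟩ := h2 v hv.1 hv.2
      refine ⟨e, ⟨he, y, ?_⟩, ?_⟩
      · rw [Graph.deleteVerts_isLink]
        exact ⟨hinc, hv.2, fun hy => h3 e he y hy hinc.inc_right⟩
      · rintro e' ⟨he', y', hinc'⟩
        rw [Graph.deleteVerts_isLink] at hinc'
        exact huniq e' ⟨he', y', hinc'.1⟩

/-- Two vertices joined by a walk with edges in `D`. -/
def Joined (G : Graph α β) (D : Set β) : α → α → Prop :=
  Relation.ReflTransGen fun u v => ∃ e ∈ D, G.IsLink e u v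

lemma Joined.symm {D : Set β} {u v : α} (h : Joined G D u v) : Joined G D v u :=
  have : Std.Symm fun u v => ∃ e ∈ D, G.IsLink e u v := ⟨fun _ _ ⟨e, he, h⟩ => ⟨e, he, h.symm⟩⟩
  (Relation.ReflTransGen.stdSymm (r := fun u v => ∃ e ∈ D, G.IsLink e u v)).symm u v h

/-- A matching defines an involution that exchanges the ends of each of its edges. -/
lemma IsMatchingOff.exists_involution {U : Set α} {M : Set β} (h : IsMatchingOff G U M)
    (hloop : ∀ e v, ¬ G.IsLink e v v) :
    ∃ f : α → α, Function.Involutive f ∧ (∀ v ∈ G.vertexSet, f v = v ↔ v ∈ U) ∧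
      (∀ e ∈ M, ∀ u v, G.IsLink e u v → f u = v) ∧
      ∀ v, f v ≠ v → ∃ e ∈ M, G.IsLink e v (f v) := by
  classical
  have hex (v : α) : ∃ w, (∃ e ∈ M, G.IsLink e v w) ∨
      ((∀ w, ¬ ∃ e ∈ M, G.IsLink e v w) ∧ w = v) := by
    by_cases hv : ∃ w, ∃ e ∈ M, G.IsLink e v w
    · exact ⟨hv.choose, Or.inl hv.choose_spec⟩
    · exact ⟨v, Or.inr ⟨not_exists.1 hv, rfl⟩⟩
  choose f hf using hex
  have huniq : ∀ e ∈ M, ∀ u v, G.IsLink e u v → f u = v := by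
    intro e he u v huv
    rcases hf u with ⟨e', he', h'⟩ | ⟨h', -⟩
    · have hu : u ∉ U := fun hu => h.not_inc e he u hu huv.inc_left
      have := (h.existsUnique u huv.left_mem hu).unique ⟨he, huv.inc_left⟩ ⟨he', h'.inc_left⟩
      subst this
      exact h'.right_unique huv
    · exact absurd ⟨e, he, huv⟩ (h' v)
  refine ⟨f, fun v => ?_, fun v hv => ⟨fun hfv => ?_, fun hU => ?_⟩, huniq, fun v hv => ?_⟩
  · rcases hf v with ⟨e, he, h'⟩ | ⟨-, h'⟩
    · exact huniq e he _ _ h'.symm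
    · rw [h', h']
  · by_contra hU
    obtain ⟨e, ⟨he, w, hinc⟩, -⟩ := h.existsUnique v hv hU
    have := huniq e he v w hinc
    rw [hfv] at this
    subst this
    exact hloop e _ hinc
  · rcases hf v with ⟨e, he, h'⟩ | ⟨-, h'⟩
    · exact absurd h'.inc_left (h.not_inc e he v hU)
    · exact h'
  · rcases hf v with h' | ⟨-, h'⟩
    · exact h'
    · exact absurd h' hv

/-- In the superposition of two matchings which together miss each vertex of `T` once, each
component that meets `T` contains exactly two vertices of `T`. -/
lemma exists_partner (hV : G.vertexSet.Finite) (hloop : ∀ e v, ¬ G.IsLink e v v)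
    {U₁ U₂ : Set α} {μ ν : Set β} (hμ : IsMatchingOff G U₁ μ) (hν : IsMatchingOff G U₂ ν)
    (hdisj : Disjoint U₁ U₂) {x : α} (hxV : x ∈ G.vertexSet) (hx : x ∈ U₁ ∪ U₂) :
    ∃ y ∈ U₁ ∪ U₂, y ≠ x ∧ Joined G (μ ∪ ν) x y ∧
      ∀ z ∈ U₁ ∪ U₂, Joined G (μ ∪ ν) x z → z = x ∨ z = y := by
  classical
  obtain ⟨f, hf, hfU, hfe, hfl⟩ := hμ.exists_involution hloop
  obtain ⟨g, hg, hgU, hge, hgl⟩ := hν.exists_involution hloop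
  -- Both matching involutions preserve the component of `x`; their fixed points in it are its
  -- vertices in `U₁ ∪ U₂`.
  set C : Set α := {v | Joined G (μ ∪ ν) x v} with hC
  have hCV : C ⊆ G.vertexSet := by
    intro v hv
    rcases Relation.ReflTransGen.cases_tail hv with rfl | ⟨w, -, e, -, h⟩
    · exact hxV
    · exact h.right_mem
  have hCf (v : α) (hv : v ∈ C) : f v ∈ C := by
    by_cases h : f v = v
    · rwa [h]
    · obtain ⟨e, he, h⟩ := hfl v h
      exact Relation.ReflTransGen.tail hv ⟨e, Or.inl he, h⟩
  have hCg (v : α) (hv : v ∈ C) : g v ∈ C := by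
    by_cases h : g v = v
    · rwa [h]
    · obtain ⟨e, he, h⟩ := hgl v h
      exact Relation.ReflTransGen.tail hv ⟨e, Or.inr he, h⟩
  have : Fintype C := (hV.subset hCV).fintype
  let f' : C → C := fun v => ⟨f v, hCf v v.2⟩
  let g' : C → C := fun v => ⟨g v, hCg v v.2⟩
  let x' : C := ⟨x, Relation.ReflTransGen.refl⟩
  have hreach : ∀ v, Joined G (μ ∪ ν) x v → ∀ hv : v ∈ C, (pairGraph f' g').Reachable x' ⟨v, hv⟩ := by
    intro v hv
    induction hv with
    | refl => exact fun _ => SimpleGraph.Reachable.refl _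
    | @tail b c hb hbc ih =>
      intro hc
      refine (ih hb).trans (SimpleGraph.Adj.reachable ?_)
      obtain ⟨e, he, hl⟩ := hbc
      rw [pairGraph, SimpleGraph.fromRel_adj]
      refine ⟨fun h => ?_, Or.inl ?_⟩
      · have := congrArg Subtype.val h
        simp only at this
        subst this
        exact hloop _ _ hl
      · rcases he with he | he
        · exact Or.inl (Subtype.ext (hfe e he _ _ hl).symm)
        · exact Or.inr (Subtype.ext (hge e he _ _ hl).symm)
  have hconn : (pairGraph f' g').Connected :=
    { preconnected := fun u v => (hreach u u.2 u.2).symm.trans (hreach v v.2 v.2)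
      nonempty := ⟨x'⟩ }
  have hiff (v : C) : (f' v = v ∨ g' v = v) ↔ (v : α) ∈ U₁ ∪ U₂ := by
    rw [Set.mem_union, ← hfU v (hCV v.2), ← hgU v (hCV v.2), Subtype.ext_iff, Subtype.ext_iff]
  have h2 := card_fixed_eq_two (f := f') (g := g') (fun v => Subtype.ext (hf v))
    (fun v => Subtype.ext (hg v)) (fun v h h' => by
      have h1 := (hfU v (hCV v.2)).1 (Subtype.ext_iff.1 h)
      have h2 := (hgU v (hCV v.2)).1 (Subtype.ext_iff.1 h')
      exact Set.disjoint_left.1 hdisj h1 h2) hconn (x := x') ((hiff x').2 hx)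
  obtain ⟨p, q, hpq, hs⟩ := Set.ncard_eq_two.1 h2
  have hmem (v : C) : (v : α) ∈ U₁ ∪ U₂ ↔ v = p ∨ v = q := by
    rw [← hiff]
    exact Set.ext_iff.1 hs v
  have hval (v : C) (z : α) (hz : Joined G (μ ∪ ν) x z) : (⟨z, hz⟩ : C) = v ↔ z = v :=
    Subtype.ext_iff
  rcases (hmem x').1 hx with hp | hq
  · refine ⟨q, (hmem q).2 (Or.inr rfl), fun h => hpq (hp.symm.trans (Subtype.ext h.symm)), q.2,
      fun z hz hxz => ?_⟩
    have := (hmem ⟨z, hxz⟩).1 hz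
    rwa [← hp, hval, hval] at this
  · refine ⟨p, (hmem p).2 (Or.inl rfl), fun h => hpq ((Subtype.ext h).trans hq), p.2,
      fun z hz hxz => ?_⟩
    have := (hmem ⟨z, hxz⟩).1 hz
    rwa [← hq, hval, hval, or_comm] at this

/-- The edges of `μ` outside the vertex set `C` together with the edges of `ν` at `C`. -/
def swapOn (G : Graph α β) (C : Set α) (μ ν : Set β) : Set β :=
  {e | (e ∈ μ ∧ ∀ v ∈ C, ¬ G.Inc e v) ∨ (e ∈ ν ∧ ∃ v ∈ C, G.Inc e v)}

/-- The exchange keeps the superposition, hence its components; this is what lets the same exchange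
be undone. -/
lemma swapOn_union_swapOn (C : Set α) (μ ν : Set β) :
    swapOn G C μ ν ∪ swapOn G C ν μ = μ ∪ ν := by
  ext e
  by_cases h : ∃ v ∈ C, G.Inc e v
  · have h' : ¬ ∀ v ∈ C, ¬ G.Inc e v := by push Not; exact h
    simp [swapOn, h, h', or_comm]
  · have h' : ∀ v ∈ C, ¬ G.Inc e v := by push Not at h; exact h
    simp only [swapOn, Set.mem_union, Set.mem_ofPred_eq, h, and_false, or_false, and_iff_left h']

lemma swapOn_swapOn (C : Set α) (μ ν : Set β) :
    swapOn G C (swapOn G C μ ν) (swapOn G C ν μ) = μ := by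
  ext e
  by_cases h : ∃ v ∈ C, G.Inc e v
  · have h' : ¬ ∀ v ∈ C, ¬ G.Inc e v := by push Not; exact h
    simp only [swapOn, Set.mem_ofPred_eq, h, h', and_false, false_or, and_true]
  · have h' : ∀ v ∈ C, ¬ G.Inc e v := by push Not at h; exact h
    simp only [swapOn, Set.mem_ofPred_eq, h, and_false, or_false, and_iff_left h']

/-- Since `C` is closed under the edges of both matchings, no such edge leaves it: the result
behaves like `ν` in `C` and like `μ` outside, also as to the missed vertices. -/
lemma IsMatchingOff.swapOn {U₁ U₂ C : Set α} {μ ν : Set β} (hμ : IsMatchingOff G U₁ μ)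
    (hν : IsMatchingOff G U₂ ν)
    (hC : ∀ e ∈ μ ∪ ν, ∀ u v, G.IsLink e u v → u ∈ C → v ∈ C) :
    IsMatchingOff G ((U₁ \ C) ∪ (U₂ ∩ C)) (swapOn G C μ ν) := by
  have hinc : ∀ e ∈ μ ∪ ν, ∀ u v, G.Inc e u → G.Inc e v → u ∈ C → v ∈ C := by
    rintro e he u v ⟨w, hw⟩ hv hu
    rcases hv.eq_or_eq_of_isLink hw with rfl | rfl
    · exact hu
    · exact hC e he _ _ hw hu
  refine ⟨?_, fun v hv hvU => ?_, ?_⟩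
  · rintro e (he | he)
    · exact hμ.subset he.1
    · exact hν.subset he.1
  · by_cases hvC : v ∈ C
    · have hvU₂ : v ∉ U₂ := fun h => hvU (Or.inr ⟨h, hvC⟩)
      obtain ⟨e, ⟨he, hev⟩, huniq⟩ := hν.existsUnique v hv hvU₂
      refine ⟨e, ⟨Or.inr ⟨he, v, hvC, hev⟩, hev⟩, ?_⟩
      rintro e' ⟨h | h, hev'⟩
      · exact absurd hev' (h.2 v hvC)
      · exact huniq e' ⟨h.1, hev'⟩
    · have hvU₁ : v ∉ U₁ := fun h => hvU (Or.inl ⟨h, hvC⟩)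
      obtain ⟨e, ⟨he, hev⟩, huniq⟩ := hμ.existsUnique v hv hvU₁
      refine ⟨e, ⟨Or.inl ⟨he, fun w hw hew => hvC (hinc e (Or.inl he) w v hew hev hw)⟩, hev⟩, ?_⟩
      rintro e' ⟨h | h, hev'⟩
      · exact huniq e' ⟨h.1, hev'⟩
      · obtain ⟨he', w, hw, hew⟩ := h
        exact absurd (hinc e' (Or.inr he') w v hew hev' hw) hvC
  · rintro e (⟨he, h⟩ | ⟨he, w, hw, hew⟩) v (⟨hvU, hvC⟩ | ⟨hvU, hvC⟩) hev
    · exact hμ.not_inc e he v hvU hev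
    · exact h v hvC hev
    · exact hvC (hinc e (Or.inr he) w v hew hev hw)
    · exact hν.not_inc e he v hvU hev

end Graph

/-! ### Condensation -/

/-- A non-crossing fixed-point-free involution of `{0, …, n-1}` changes the parity. -/
lemma neg_one_pow_add_of_noncrossing {n : ℕ} {t : Fin n → Fin n} (ht : Function.Involutive t)
    (hne : ∀ i, t i ≠ i) (hcross : ∀ i j, i < j → j < t i → ¬ t i < t j) (i : Fin n) :
    (-1 : ℝ) ^ (i : ℕ) + (-1) ^ (t i : ℕ) = 0 := by
  wlog hlt : i < t i generalizing i
  · have := this (t i) (by rw [ht]; exact lt_of_le_of_ne (not_lt.1 hlt) (hne i))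
    rwa [ht, add_comm] at this
  -- By non-crossing, `t` maps the indices strictly between `i` and `t i` to themselves without
  -- fixed points, so their number is even.
  have h : ∑ k ∈ Finset.Ioo i (t i), (1 : ZMod 2) = 0 := by
    refine Finset.sum_involution (fun v _ => t v) (fun v _ => ?_) (fun v hv _ => hne v)
      (fun v hv => ?_) (fun v _ => ht v)
    · decide
    · rw [Finset.mem_Ioo] at hv ⊢
      have h1 : t v ≠ i := fun h => hv.2.ne (by rw [← h, ht])
      have h2 : t v ≠ t i := fun h => hv.1.ne' (ht.injective h)
      refine ⟨lt_of_le_of_ne (not_lt.1 fun h => ?_) h1.symm,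
        lt_of_le_of_ne (not_lt.1 (hcross i v hv.1 hv.2)) h2⟩
      exact hcross (t v) i h (by rw [ht]; exact hv.1) (by rw [ht]; exact hv.2)
  rw [Finset.sum_const, nsmul_one, ZMod.natCast_eq_zero_iff, Fin.card_Ioo] at h
  have hlt' : (i : ℕ) < t i := hlt
  obtain ⟨k, hk⟩ := h
  have : (t i : ℕ) = i + 2 * k + 1 := by omega
  rw [this, pow_succ, pow_add, pow_mul]
  simp

section Graph

variable {α β : Type*} {G : Graph α β}

open Classical in
/-- Condensation of perfect matchings in a graph in which the vertices `b 0, …, b (n-1)` are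
placed as on the boundary of a disc. -/
theorem sum_matchingCount_mul_eq_zero (hV : G.vertexSet.Finite) (hE : G.edgeSet.Finite)
    (hloop : ∀ e v, ¬ G.IsLink e v v) {n : ℕ} {b : Fin n → α} (hb : Function.Injective b)
    (hbV : ∀ i, b i ∈ G.vertexSet)
    (hcross : ∀ D i j k l, i < j → j < k → k < l → Joined G D (b i) (b k) →
      Joined G D (b j) (b l) → Joined G D (b i) (b j))
    (X : Set (Fin n)) :
    ∑ j : Fin n, (-1 : ℝ) ^ (j : ℕ) *
      ((matchingCount (G.deleteVerts (b '' symmDiff X {j})) : ℝ) *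
        matchingCount (G.deleteVerts (b '' (symmDiff X {j})ᶜ))) = 0 := by
  set Ω : Fin n → Set (Set β × Set β) := fun j =>
    {M | IsMatchingOff G (b '' symmDiff X {j}) M} ×ˢ
      {M | IsMatchingOff G (b '' (symmDiff X {j})ᶜ) M} with hΩ
  have hfin (j : Fin n) : (Ω j).Finite := by
    refine Set.Finite.prod ?_ ?_ <;>
    exact hE.finite_subsets.subset fun M hM => hM.subset
  have hpart : ∀ j, ∀ p ∈ Ω j, ∀ i, ∃ l, l ≠ i ∧ Joined G (p.1 ∪ p.2) (b i) (b l) ∧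
      ∀ k, Joined G (p.1 ∪ p.2) (b i) (b k) → k = i ∨ k = l := by
    rintro j ⟨μ, ν⟩ ⟨hμ, hν⟩ i
    have hall (k : Fin n) : b k ∈ b '' symmDiff X {j} ∪ b '' (symmDiff X {j})ᶜ := by
      rw [← Set.image_union, Set.union_compl_self]
      exact ⟨k, trivial, rfl⟩
    obtain ⟨y, hy, hyx, hj, huniq⟩ := exists_partner hV hloop hμ hν
      ((Set.disjoint_image_iff hb).2 disjoint_compl_right) (hbV i) (hall i)
    rw [← Set.image_union] at hy
    obtain ⟨l, -, rfl⟩ := hy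
    refine ⟨l, fun h => hyx (h ▸ rfl), hj, fun k hk => ?_⟩
    exact (huniq (b k) (hall k) hk).imp (fun h => hb h) (fun h => hb h)
  -- `τ D i` is the other end of the path from `b i`. The default value `i` never occurs for the
  -- superpositions considered, by `hpart`.
  set τ : Set β → Fin n → Fin n := fun D i =>
    if h : ∃ l, l ≠ i ∧ Joined G D (b i) (b l) ∧ ∀ k, Joined G D (b i) (b k) → k = i ∨ k = l
    then h.choose else i with hτ
  have hτspec : ∀ j, ∀ p ∈ Ω j, ∀ i, τ (p.1 ∪ p.2) i ≠ i ∧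
      Joined G (p.1 ∪ p.2) (b i) (b (τ (p.1 ∪ p.2) i)) ∧
      ∀ k, Joined G (p.1 ∪ p.2) (b i) (b k) → k = i ∨ k = τ (p.1 ∪ p.2) i := by
    intro j p hp i
    have h := hpart j p hp i
    simp only [hτ, dif_pos h]
    exact h.choose_spec
  have hτinv : ∀ j, ∀ p ∈ Ω j, Function.Involutive (τ (p.1 ∪ p.2)) := by
    intro j p hp i
    obtain ⟨h1, h2, -⟩ := hτspec j p hp i
    obtain ⟨-, -, h3⟩ := hτspec j p hp (τ (p.1 ∪ p.2) i)
    exact ((h3 i h2.symm).resolve_left h1.symm).symm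
  set comp : Set β → Fin n → Set α := fun D i => {v | Joined G D (b i) v} with hcomp
  set sw : Fin n → Set β × Set β → Set β × Set β := fun j p =>
    (swapOn G (comp (p.1 ∪ p.2) j) p.1 p.2, swapOn G (comp (p.1 ∪ p.2) j) p.2 p.1) with hsw
  have hswu (j p) : (sw j p).1 ∪ (sw j p).2 = p.1 ∪ p.2 := swapOn_union_swapOn _ _ _
  have hcompτ : ∀ j, ∀ p ∈ Ω j,
      comp (p.1 ∪ p.2) (τ (p.1 ∪ p.2) j) = comp (p.1 ∪ p.2) j := by
    intro j p hp
    have h := (hτspec j p hp j).2.1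
    ext v
    exact ⟨fun hv => h.trans hv, fun hv => h.symm.trans hv⟩
  have hswmem : ∀ j, ∀ p ∈ Ω j, sw j p ∈ Ω (τ (p.1 ∪ p.2) j) := by
    rintro j ⟨μ, ν⟩ hp
    obtain ⟨h1, h2, h3⟩ := hτspec j _ hp j
    obtain ⟨hμ, hν⟩ := hp
    have hC : ∀ e ∈ μ ∪ ν, ∀ u v, G.IsLink e u v → u ∈ comp (μ ∪ ν) j → v ∈ comp (μ ∪ ν) j :=
      fun e he u v huv hu => Relation.ReflTransGen.tail hu ⟨e, he, huv⟩
    have hbC (i : Fin n) : b i ∈ comp (μ ∪ ν) j ↔ i = j ∨ i = τ (μ ∪ ν) j :=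
      ⟨fun h => h3 i h, by rintro (rfl | rfl); exacts [Relation.ReflTransGen.refl, h2]⟩
    have key (Y Z : Set (Fin n))
        (hYZ : ∀ i, i ∈ Z ↔ ((i ∈ Y ∧ ¬ (i = j ∨ i = τ (μ ∪ ν) j)) ∨
          (i ∉ Y ∧ (i = j ∨ i = τ (μ ∪ ν) j)))) :
        (b '' Y) \ comp (μ ∪ ν) j ∪ (b '' Yᶜ) ∩ comp (μ ∪ ν) j = b '' Z := by
      ext v
      constructor
      · rintro (⟨⟨i, hi, rfl⟩, hv⟩ | ⟨⟨i, hi, rfl⟩, hv⟩)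
        · exact ⟨i, (hYZ i).2 (Or.inl ⟨hi, by rwa [← hbC]⟩), rfl⟩
        · exact ⟨i, (hYZ i).2 (Or.inr ⟨hi, by rwa [← hbC]⟩), rfl⟩
      · rintro ⟨i, hi, rfl⟩
        rcases (hYZ i).1 hi with h | h
        · exact Or.inl ⟨⟨i, h.1, rfl⟩, by rw [hbC]; exact h.2⟩
        · exact Or.inr ⟨⟨i, h.1, rfl⟩, by rw [hbC]; exact h.2⟩
    -- The component contains exactly two of the boundary vertices, those of index `j` and `τ j`.
    -- Flipping the membership of both turns `X ∆ {j}` into `X ∆ {τ j}`.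
    have hflip (i : Fin n) : i ∈ symmDiff X {τ (μ ∪ ν) j} ↔
        ((i ∈ symmDiff X {j} ∧ ¬ (i = j ∨ i = τ (μ ∪ ν) j)) ∨
          (i ∉ symmDiff X {j} ∧ (i = j ∨ i = τ (μ ∪ ν) j))) := by
      simp only [Set.mem_symmDiff, Set.mem_singleton_iff]
      by_cases hi : i = j
      · subst hi
        have : i ≠ τ (μ ∪ ν) i := h1.symm
        simp only [this]
        tauto
      · by_cases hi' : i = τ (μ ∪ ν) j
        · simp only [hi']
          tauto
        · simp only [hi, hi']
          tauto
    constructor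
    · have := hμ.swapOn hν hC
      rwa [key _ _ hflip] at this
    · have := hν.swapOn hμ (C := comp (μ ∪ ν) j) (by rwa [Set.union_comm])
      nth_rewrite 2 [← compl_compl (symmDiff X {j})] at this
      rwa [key _ (symmDiff X {τ (μ ∪ ν) j})ᶜ] at this
      intro i
      rw [Set.mem_compl_iff, Set.mem_compl_iff, hflip]
      tauto
  have hsum (j : Fin n) : (-1 : ℝ) ^ (j : ℕ) *
      ((matchingCount (G.deleteVerts (b '' symmDiff X {j})) : ℝ) *
        matchingCount (G.deleteVerts (b '' (symmDiff X {j})ᶜ))) =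
      ∑ p ∈ (hfin j).toFinset, (-1 : ℝ) ^ (j : ℕ) := by
    rw [Finset.sum_const, ← Set.ncard_eq_toFinset_card _ (hfin j), hΩ, Set.ncard_prod, nsmul_eq_mul,
      mul_comm]
    simp only [matchingCount, isPerfectMatching_deleteVerts]
    push_cast
    rfl
  simp only [hsum]
  rw [← Finset.sum_sigma (σ := fun _ : Fin n => Set β × Set β) Finset.univ
    (fun j => (hfin j).toFinset) (fun x => (-1 : ℝ) ^ (x.1 : ℕ))]
  -- The sign-reversing involution: swap along the path from `b j` and make its other end the
  -- distinguished index.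
  refine Finset.sum_involution (fun x _ => ⟨τ (x.2.1 ∪ x.2.2) x.1, sw x.1 x.2⟩) ?_ ?_ ?_ ?_
  · rintro ⟨j, p⟩ hp
    have hp : p ∈ Ω j := by simpa using hp
    refine neg_one_pow_add_of_noncrossing (hτinv j p hp) (fun i => (hτspec j p hp i).1)
      (fun i k hik hk hlt => ?_) j
    have h := hcross _ _ _ _ _ hik hk hlt (hτspec j p hp i).2.1 (hτspec j p hp k).2.1
    rcases (hτspec j p hp i).2.2 k h with h | h
    · exact hik.ne' h
    · exact hk.ne h
  · rintro ⟨j, p⟩ hp - h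
    have hp : p ∈ Ω j := by simpa using hp
    exact (hτspec j p hp j).1 (congrArg Sigma.fst h)
  · rintro ⟨j, p⟩ hp
    have hp : p ∈ Ω j := by simpa using hp
    simpa using hswmem j p hp
  · rintro ⟨j, p⟩ hp
    have hp : p ∈ Ω j := by simpa using hp
    have e1 : τ ((sw j p).1 ∪ (sw j p).2) (τ (p.1 ∪ p.2) j) = j := by
      rw [hswu]
      exact hτinv j p hp j
    have e2 : sw (τ (p.1 ∪ p.2) j) (sw j p) = p := by
      simp only [hsw, swapOn_union_swapOn, hcompτ j p hp, swapOn_swapOn]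
    simp only [e1, e2]

end Graph

end ChordTNNP
end

noncomputable section

namespace ChordTNNP

open Complex ComplexConjugate

/-! ### Logarithms of chords of the unit disc -/

/-- The product `w * conj z` lies in the closed unit disc, where only the point `1` has real part
`1`. Hence the principal logarithm below never meets its cut. -/
lemma re_one_sub_mul_conj_pos {z w : ℂ} (hz : ‖z‖ = 1) (hw : ‖w‖ ≤ 1) (hne : w ≠ z) :
    0 < (1 - w * conj z).re := by
  rw [sub_re, one_re, sub_pos]
  have hn : ‖w * conj z‖ ≤ 1 := by rwa [norm_mul, norm_conj, hz, mul_one]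
  refine lt_of_le_of_ne ((re_le_norm _).trans hn) fun h => hne ?_
  have h1 : ‖w * conj z‖ = 1 := le_antisymm hn (h ▸ re_le_norm _)
  have h2 : w * conj z = 1 := by
    have hsq := Complex.sq_norm (w * conj z)
    rw [h1, normSq_apply, h] at hsq
    refine Complex.ext h ?_
    rw [one_im]
    nlinarith
  calc w = w * (conj z * z) := by rw [conj_mul', hz]; simp
    _ = z := by rw [← mul_assoc, h2, one_mul]

/-- A branch of the logarithm of `1 - w / z`, for `z` on the unit circle and `w` in the closed
unit disc. -/
def viewLog (z w : ℂ) : ℂ := log (1 - w * conj z)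

lemma abs_im_viewLog_lt {z w : ℂ} (hz : ‖z‖ = 1) (hw : ‖w‖ ≤ 1) (hne : w ≠ z) :
    |(viewLog z w).im| < Real.pi / 2 := by
  rw [viewLog, log_im, abs_arg_lt_pi_div_two_iff]
  exact Or.inl (re_one_sub_mul_conj_pos hz hw hne)

lemma exp_viewLog {z w : ℂ} (hz : ‖z‖ = 1) (hw : ‖w‖ ≤ 1) (hne : w ≠ z) :
    exp (viewLog z w) = 1 - w * conj z := by
  refine exp_log fun h => ?_
  have := re_one_sub_mul_conj_pos hz hw hne
  simp [h] at this

lemma one_sub_mul_conj_eq {z : ℂ} (hz : ‖z‖ = 1) (w : ℂ) :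
    1 - w * conj z = conj z * (z - w) := by
  have : conj z * z = 1 := by rw [conj_mul', hz]; simp
  linear_combination -this

lemma viewLog_symm {z w : ℂ} (hz : ‖z‖ = 1) (hw : ‖w‖ ≤ 1) (hne : w ≠ z) :
    viewLog w z = conj (viewLog z w) := by
  have h := re_one_sub_mul_conj_pos hz hw hne
  rw [viewLog, viewLog, ← log_conj _ (slitPlane_arg_ne_pi (Or.inl h))]
  simp [mul_comm]

/-- Seen from a point `z` of the unit circle, the logarithms of the quotients
`(v - z) / (u - z)` are additive. -/
lemma log_div_eq_viewLog_sub {z u v : ℂ} (hz : ‖z‖ = 1) (hu : ‖u‖ ≤ 1) (hv : ‖v‖ ≤ 1)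
    (huz : u ≠ z) (hvz : v ≠ z) :
    log ((v - z) / (u - z)) = viewLog z v - viewLog z u := by
  have hu' := abs_lt.1 (abs_im_viewLog_lt hz hu huz)
  have hv' := abs_lt.1 (abs_im_viewLog_lt hz hv hvz)
  have h0 : conj z ≠ 0 := by
    rw [Ne, ← norm_eq_zero, norm_conj, hz]
    norm_num
  have hexp : exp (viewLog z v - viewLog z u) = (v - z) / (u - z) := by
    rw [exp_sub, exp_viewLog hz hu huz, exp_viewLog hz hv hvz, one_sub_mul_conj_eq hz,
      one_sub_mul_conj_eq hz, mul_div_mul_left _ _ h0, ← neg_sub v z, ← neg_sub u z, neg_div_neg_eq]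
  -- Imaginary parts of modulus below `π / 2` differ by less than `π`, so the difference is again
  -- the principal value.
  rw [← hexp, log_exp]
  · rw [sub_im]; linarith
  · rw [sub_im]; linarith

lemma continuousOn_viewLog {u : ℂ} (hu : ‖u‖ = 1) {K : Set ℂ} (hK : ∀ z ∈ K, ‖z‖ ≤ 1)
    (huK : u ∉ K) : ContinuousOn (viewLog u) K := by
  refine ContinuousOn.clog (by fun_prop) fun z hz => Or.inl ?_
  exact re_one_sub_mul_conj_pos hu (hK z hz) fun h => huK (h ▸ hz)

/-- For two points `u`, `v` of the unit circle, `(v - z) / (u - z)` has a logarithm in the closed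
unit disc. -/
lemma exp_viewLog_sub {u v z : ℂ} (hu : ‖u‖ = 1) (hv : ‖v‖ = 1) (hz : ‖z‖ ≤ 1)
    (hzu : z ≠ u) (hzv : z ≠ v) :
    exp (viewLog v z - viewLog u z) = conj v / conj u * ((v - z) / (u - z)) := by
  rw [exp_sub, exp_viewLog hv hz hzv, exp_viewLog hu hz hzu, one_sub_mul_conj_eq hv,
    one_sub_mul_conj_eq hu, mul_div_mul_comm]

/-- If the quotient were real and at most `0`, then `v - z` and `u - z` would point in opposite
directions (or `v = z`), which puts `z` between `u` and `v`. -/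
lemma div_sub_mem_slitPlane {u v z : ℂ} (hz : z ∉ segment ℝ u v) :
    (v - z) / (u - z) ∈ slitPlane := by
  have huz : u - z ≠ 0 := fun h => hz (sub_eq_zero.1 h ▸ left_mem_segment ℝ u v)
  rw [mem_slitPlane_iff_not_le_zero]
  intro h
  obtain ⟨h1, h2⟩ := Complex.le_def.1 h
  set q := (v - z) / (u - z) with hq
  have hqr : q = (q.re : ℂ) := Complex.ext rfl (by simpa using h2)
  have hv : v - z = q.re * (u - z) := by
    rw [← hqr, hq, div_mul_cancel₀ _ huz]
  refine hz (mem_segment_iff_sameRay.2 ?_)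
  have hv' : v - z = (-q.re) • (z - u) := by
    rw [hv, real_smul]
    push_cast
    ring
  rw [hv']
  exact SameRay.sameRay_nonneg_smul_right _ (by simpa using h1)

/-- A continuous logarithm of a constant on a connected set is constant. -/
lemma eq_of_exp_eq_const {K : Set ℂ} (hK : IsPreconnected K) {H : ℂ → ℂ} (hH : ContinuousOn H K)
    {c : ℂ} (hc : ∀ z ∈ K, exp (H z) = c) {z w : ℂ} (hz : z ∈ K) (hw : w ∈ K) : H z = H w := by
  have hpi : (2 * Real.pi * I : ℂ) ≠ 0 := by simp [Real.pi_ne_zero]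
  have hmaps : Set.MapsTo (fun x => (H x - H w) / (2 * Real.pi * I)) K
      (Set.range ((↑) : ℤ → ℂ)) := by
    intro x hx
    obtain ⟨n, hn⟩ := exp_eq_exp_iff_exists_int.1 ((hc x hx).trans (hc w hw).symm)
    refine ⟨n, ?_⟩
    simp only
    rw [hn, add_sub_cancel_left, mul_div_cancel_right₀ _ hpi]
  have hdisc : IsDiscrete (Set.range ((↑) : ℤ → ℂ)) :=
    ⟨Complex.isClosedEmbedding_intCast.isEmbedding.toHomeomorph.symm.isEmbedding.discreteTopology⟩
  obtain ⟨y, -, hy⟩ := hK.eqOn_const_of_mapsTo hdisc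
    (f := fun x => (H x - H w) / (2 * Real.pi * I)) (by fun_prop) hmaps ⟨0, 0, by simp⟩
  have h1 := hy hz
  have h2 := hy hw
  simp only [Function.const_apply, sub_self, zero_div] at h1 h2
  rw [← h2, div_eq_zero_iff, sub_eq_zero] at h1
  exact h1.resolve_right hpi

lemma one_sub_exp_mul_I (φ : ℝ) : 1 - exp (φ * I) = (2 * Real.sin (φ / 2) : ℝ) *
    (cos (((φ - Real.pi) / 2 : ℝ)) + sin (((φ - Real.pi) / 2 : ℝ)) * I) := by
  have h1 : Real.cos ((φ - Real.pi) / 2) = Real.sin (φ / 2) := by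
    rw [sub_div, Real.cos_sub_pi_div_two]
  have h2 : Real.sin ((φ - Real.pi) / 2) = -Real.cos (φ / 2) := by
    rw [sub_div, Real.sin_sub_pi_div_two]
  have h3 : Real.cos φ = 1 - 2 * Real.sin (φ / 2) ^ 2 := by
    have := Real.cos_two_mul (φ / 2)
    rw [mul_div_cancel₀ φ two_ne_zero] at this
    have h4 := Real.sin_sq_add_cos_sq (φ / 2)
    linarith
  have h5 : Real.sin φ = 2 * Real.sin (φ / 2) * Real.cos (φ / 2) := by
    rw [← Real.sin_two_mul, mul_div_cancel₀ φ two_ne_zero]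
  rw [exp_mul_I, ← ofReal_cos, ← ofReal_sin, ← ofReal_cos, ← ofReal_sin, h1, h2, h3, h5]
  push_cast
  ring

lemma arg_one_sub_exp_mul_I {φ : ℝ} (h0 : 0 < φ) (h1 : φ < 2 * Real.pi) :
    arg (1 - exp (φ * I)) = (φ - Real.pi) / 2 := by
  rw [one_sub_exp_mul_I]
  refine arg_mul_cos_add_sin_mul_I ?_ ⟨by linarith, by linarith⟩
  exact mul_pos two_pos (Real.sin_pos_of_pos_of_lt_pi (by linarith) (by linarith))

namespace ChordDiagram

variable {N : ℕ} (D : ChordDiagram N)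

/-! ### Boundary points -/

lemma norm_pt (i : Fin (2 * N)) : ‖D.pt i‖ = 1 := Circle.norm_coe _

lemma pt_mul_conj_pt (t k : Fin (2 * N)) :
    D.pt t * conj (D.pt k) = exp ((D.angle t - D.angle k : ℝ) * I) := by
  rw [pt, pt, Circle.coe_exp, Circle.coe_exp, ← exp_conj, ← Complex.exp_add]
  congr 1
  simp only [map_mul, conj_ofReal, conj_I]
  push_cast
  ring

/-- An inscribed angle. The order of the indices enters here: for `t < k` the difference of angles
needs `2π` added to lie in `(0, 2π)`, and halving leaves `π`. -/
lemma im_viewLog_pt {t k : Fin (2 * N)} (h : t ≠ k) :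
    (viewLog (D.pt k) (D.pt t)).im =
      (D.angle t - D.angle k - Real.pi) / 2 + if t < k then Real.pi else 0 := by
  rw [viewLog, log_im, pt_mul_conj_pt]
  have h1 := D.angle_lt t k
  have h2 := D.angle_lt k t
  split_ifs with hlt
  · have h3 := D.angle_strictMono hlt
    have : exp ((D.angle t - D.angle k : ℝ) * I) =
        exp ((D.angle t - D.angle k + 2 * Real.pi : ℝ) * I) := by
      push_cast
      rw [add_mul _ (2 * (Real.pi : ℂ)), Complex.exp_periodic]
    rw [this, arg_one_sub_exp_mul_I (by linarith) (by linarith)]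
    ring
  · have h3 := D.angle_strictMono (lt_of_le_of_ne (not_lt.1 hlt) h.symm)
    rw [arg_one_sub_exp_mul_I (by linarith) (by linarith), add_zero]

lemma pt_injective : Function.Injective D.pt := by
  intro i j hij
  by_contra hne
  wlog hlt : i < j generalizing i j
  · exact this hij.symm (Ne.symm hne) (lt_of_le_of_ne (not_lt.1 hlt) (Ne.symm hne))
  have h1 := D.angle_strictMono hlt
  have h2 := D.angle_lt j i
  have h3 := arg_one_sub_exp_mul_I (φ := D.angle j - D.angle i) (by linarith) (by linarith)
  have e1 : exp ((D.angle j - D.angle i : ℝ) * I) = 1 := by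
    rw [← pt_mul_conj_pt, hij, mul_conj', norm_pt]
    simp
  rw [e1, sub_self, arg_zero] at h3
  have := Real.pi_pos
  have hs : (0 : ℝ) < Real.sin ((D.angle j - D.angle i) / 2) :=
    Real.sin_pos_of_pos_of_lt_pi (by linarith) (by linarith)
  have e3 := one_sub_exp_mul_I (D.angle j - D.angle i)
  rw [e1, sub_self, show D.angle j - D.angle i - Real.pi = 0 by linarith] at e3
  simp only [zero_div, ofReal_zero, Complex.cos_zero, Complex.sin_zero, zero_mul, add_zero,
    mul_one] at e3
  have := ofReal_eq_zero.1 e3.symm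
  linarith

/-- Whether an index lies behind `i` or behind the cyclically next index makes the same difference
for all other indices. -/
lemma exists_if_rotate_sub (i : Fin (2 * N)) : ∃ C : ℝ, ∀ k, k ≠ i → k ≠ finRotate (2 * N) i →
    ((if finRotate (2 * N) i < k then Real.pi else 0) - if i < k then Real.pi else 0) = C := by
  obtain ⟨n, hn⟩ : ∃ n, 2 * N = n + 1 := ⟨2 * N - 1, by have := i.2; omega⟩
  generalize 2 * N = m at *
  subst hn
  -- Only the last index wraps around, to `0`, and then every other index changes sides. Otherwise
  -- no index lies between `i` and its successor.
  by_cases hi : i = Fin.last n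
  · subst hi
    refine ⟨Real.pi, fun k hk hk' => ?_⟩
    rw [finRotate_last] at *
    rw [if_pos (Fin.pos_iff_ne_zero.2 hk'), if_neg (Fin.le_last k).not_gt, sub_zero]
  · refine ⟨0, fun k hk hk' => ?_⟩
    have hv := coe_finRotate_of_ne_last hi
    have : finRotate (n + 1) i < k ↔ i < k := by
      rw [Fin.lt_def, Fin.lt_def, hv]
      have : (k : ℕ) ≠ finRotate (n + 1) i := fun h => hk' (Fin.ext h)
      rw [hv] at this
      omega
    simp only [this, sub_self]

/-- Two cyclically consecutive indices lie on the same side of two further ones. -/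
lemma if_sub_if_rotate {a b i : Fin (2 * N)} (ha : a ≠ i) (ha' : a ≠ finRotate (2 * N) i)
    (hb : b ≠ i) (hb' : b ≠ finRotate (2 * N) i) :
    ((if b < finRotate (2 * N) i then Real.pi else 0) -
      if a < finRotate (2 * N) i then Real.pi else 0) =
    ((if b < i then Real.pi else 0) - if a < i then Real.pi else 0) := by
  obtain ⟨C, hC⟩ := exists_if_rotate_sub i
  have h (k j : Fin (2 * N)) (hkj : k ≠ j) :
      (if k < j then Real.pi else 0) = Real.pi - if j < k then Real.pi else 0 := by
    rcases lt_or_gt_of_ne hkj with h | h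
    · rw [if_pos h, if_neg h.not_gt, sub_zero]
    · rw [if_pos h, if_neg h.not_gt, sub_self]
  rw [h _ _ ha, h _ _ ha', h _ _ hb, h _ _ hb']
  have h1 := hC a ha ha'
  have h2 := hC b hb hb'
  linarith

/-! ### Pieces of chords -/

variable {D} {P : Finset ℂ}

lemma norm_le_one_of_mem_chord {i : Fin (2 * N)} {z : ℂ} (hz : z ∈ D.chord i) : ‖z‖ ≤ 1 := by
  have h := (convex_closedBall (0 : ℂ) 1).segment_subset (x := D.pt i) (y := D.pt (D.mate i))
    (by simp [norm_pt]) (by simp [norm_pt]) hz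
  simpa using h

lemma chord_mate (i : Fin (2 * N)) : D.chord (D.mate i) = D.chord i := by
  rw [chord, chord, D.mate_mate, segment_symm]

lemma Consecutive.eq_or_eq {u v w : ℂ} (h : D.Consecutive P u v) (hw : w ∈ D.vertices P)
    (hwuv : w ∈ segment ℝ u v) : w = u ∨ w = v := by
  rw [← insert_endpoints_openSegment] at hwuv
  rcases hwuv with hw' | hw' | hw'
  · exact Or.inl hw'
  · exact Or.inr hw'
  · exact absurd hw (Set.disjoint_left.1 h.2.2.2.2 hw')

/-- Pieces of chords without a common end are disjoint. -/
lemma Consecutive.disjoint (hP : D.IsInterior P) {u v x y : ℂ} (h : D.Consecutive P u v)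
    (h' : D.Consecutive P x y) (hux : u ≠ x) (huy : u ≠ y) (hvx : v ≠ x) (hvy : v ≠ y) :
    Disjoint (segment ℝ u v) (segment ℝ x y) := by
  rw [Set.disjoint_left]
  intro z hz hz'
  have hzV : z ∉ D.vertices P := by
    intro hzV
    rcases h.eq_or_eq hzV hz with rfl | rfl <;> rcases h'.eq_or_eq hzV hz' with rfl | rfl <;>
      contradiction
  obtain ⟨huv, huV, hvV, ⟨i, hui, hvi⟩, hd⟩ := h
  obtain ⟨hxy, hxV, hyV, ⟨j, hxj, hyj⟩, hd'⟩ := h'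
  have hzi : z ∈ D.chord i := (convex_segment _ _).segment_subset hui hvi hz
  have hzj : z ∈ D.chord j := (convex_segment _ _).segment_subset hxj hyj hz'
  -- A common point on different chords would be an intersection point, hence a vertex. So the
  -- pieces lie on one chord and are compared as intervals of its parameter.
  have hij : D.chord j = D.chord i := by
    by_cases h1 : j = i
    · rw [h1]
    · by_cases h2 : j = D.mate i
      · rw [h2, chord_mate]
      · exact absurd (Or.inr (hP.2 ⟨i, j, h1, h2, hzi, hzj⟩)) hzV
  rw [hij] at hxj hyj
  have hAB : D.pt i ≠ D.pt (D.mate i) := fun h => D.mate_ne i (D.pt_injective h).symm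
  set L : ℝ →ᵃ[ℝ] ℂ := AffineMap.lineMap (D.pt i) (D.pt (D.mate i)) with hL
  have hLinj : Function.Injective L := AffineMap.lineMap_injective ℝ hAB
  rw [chord, segment_eq_image_lineMap] at hui hvi hxj hyj hzi
  obtain ⟨tu, -, rfl⟩ := hui
  obtain ⟨tv, -, rfl⟩ := hvi
  obtain ⟨tx, -, rfl⟩ := hxj
  obtain ⟨ty, -, rfl⟩ := hyj
  obtain ⟨tz, -, rfl⟩ := hzi
  rw [← hL] at *
  have hmem (a b c : ℝ) (hab : a ≠ b) : L c ∈ openSegment ℝ (L a) (L b) ↔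
      c ∈ Set.Ioo (min a b) (max a b) := by
    rw [← image_openSegment, hLinj.mem_set_image, openSegment_eq_Ioo' hab]
  have huv' : tu ≠ tv := fun h => huv (h ▸ rfl)
  have hxy' : tx ≠ ty := fun h => hxy (h ▸ rfl)
  have ho {a b c : ℂ} (hc : c ∈ segment ℝ a b) (ha : a ∈ D.vertices P) (hb : b ∈ D.vertices P)
      (hcV : c ∉ D.vertices P) : c ∈ openSegment ℝ a b := by
    rw [← insert_endpoints_openSegment] at hc
    rcases hc with rfl | rfl | hc
    · contradiction
    · contradiction
    · exact hc
  -- Two open intervals that share a point, neither containing an end of the other, have the same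
  -- ends.
  have z1 := (hmem _ _ _ huv').1 (ho hz huV hvV hzV)
  have z2 := (hmem _ _ _ hxy').1 (ho hz' hxV hyV hzV)
  have n1 := mt (hmem _ _ tx huv').2 fun h => Set.disjoint_left.1 hd h hxV
  have n2 := mt (hmem _ _ ty huv').2 fun h => Set.disjoint_left.1 hd h hyV
  have n3 := mt (hmem _ _ tu hxy').2 fun h => Set.disjoint_left.1 hd' h huV
  have n4 := mt (hmem _ _ tv hxy').2 fun h => Set.disjoint_left.1 hd' h hvV
  have e1 : tu ≠ tx := fun h => hux (h ▸ rfl)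
  have e2 : tu ≠ ty := fun h => huy (h ▸ rfl)
  have e3 : tv ≠ tx := fun h => hvx (h ▸ rfl)
  have e4 : tv ≠ ty := fun h => hvy (h ▸ rfl)
  simp only [Set.mem_Ioo, min_lt_iff, lt_max_iff] at *
  grind

end ChordDiagram
end ChordTNNP
end

noncomputable section

namespace ChordTNNP
namespace ChordDiagram

open Complex ComplexConjugate

variable {N : ℕ} {D : ChordDiagram N} {P : Finset ℂ} {S : Set (Fin (2 * N))}

/-! ### Walks with interleaved ends meet -/

/-- A function whose increments along a walk from `s` to `x` measure the angle at which the walk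
is seen from the points of `K`. -/
def IsPotential (D : ChordDiagram N) (K : Set ℂ) (s x : ℂ) (F : ℂ → ℂ) : Prop :=
  ContinuousOn F K ∧ (∃ c, ∀ z ∈ K, exp (F z) = c * ((x - z) / (s - z))) ∧
    ∃ C, ∀ k, D.pt k ∈ K → F (D.pt k) = C + viewLog (D.pt k) x - viewLog (D.pt k) s

lemma isPotential_refl {K : Set ℂ} {s : ℂ} (hs : s ∉ K) : IsPotential D K s s fun _ => 0 := by
  refine ⟨continuousOn_const, ⟨1, fun z hz => ?_⟩, 0, fun k _ => by ring⟩
  have : s - z ≠ 0 := sub_ne_zero.2 fun h => hs (h ▸ hz)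
  rw [exp_zero, div_self this, one_mul]

/-- Off the segment the principal logarithm of `(v - z) / (u - z)` is continuous, and at boundary
points it is a difference of values of `viewLog`; so `c` and `C` are kept. -/
lemma IsPotential.add_segment {K : Set ℂ} {s u v : ℂ} {F : ℂ → ℂ} (hF : IsPotential D K s u F)
    (hu : ‖u‖ ≤ 1) (hv : ‖v‖ ≤ 1) (hK : Disjoint (segment ℝ u v) K) :
    IsPotential D K s v fun z => F z + log ((v - z) / (u - z)) := by
  obtain ⟨h1, ⟨c, h2⟩, C, h3⟩ := hF
  have hsegz : ∀ z ∈ K, z ∉ segment ℝ u v := fun z hz hz' => Set.disjoint_left.1 hK hz' hz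
  have huz : ∀ z ∈ K, u ≠ z := fun z hz h => hsegz z hz (h ▸ left_mem_segment ℝ u v)
  have hvz : ∀ z ∈ K, v ≠ z := fun z hz h => hsegz z hz (h ▸ right_mem_segment ℝ u v)
  refine ⟨h1.add (ContinuousOn.clog ?_ fun z hz => div_sub_mem_slitPlane (hsegz z hz)),
    ⟨c, fun z hz => ?_⟩, C, fun k hk => ?_⟩
  · exact ContinuousOn.div (by fun_prop) (by fun_prop) fun z hz => sub_ne_zero.2 (huz z hz)
  · have hu0 := sub_ne_zero.2 (huz z hz)
    have hv0 := sub_ne_zero.2 (hvz z hz)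
    rw [Complex.exp_add, h2 z hz, exp_log (div_ne_zero hv0 hu0), mul_assoc, mul_comm,
      div_mul_div_comm, mul_comm (u - z), mul_div_mul_right _ _ hu0, mul_comm]
  · beta_reduce
    rw [h3 k hk, log_div_eq_viewLog_sub (D.norm_pt k) hu hv (huz _ hk) (hvz _ hk)]
    ring

/-- The difference of the two logarithms of `(v - z) / (u - z)` for boundary points. -/
lemma viewLog_sub_viewLog_pt {i j k : Fin (2 * N)} (hi : i ≠ k) (hj : j ≠ k) :
    viewLog (D.pt j) (D.pt k) - viewLog (D.pt i) (D.pt k) =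
      viewLog (D.pt k) (D.pt j) - viewLog (D.pt k) (D.pt i) -
        (((D.angle j - D.angle i) + 2 * ((if j < k then Real.pi else 0) -
          if i < k then Real.pi else 0) : ℝ) : ℂ) * I := by
  have key (t : Fin (2 * N)) (ht : t ≠ k) : viewLog (D.pt t) (D.pt k) =
      viewLog (D.pt k) (D.pt t) - ((2 * ((D.angle t - D.angle k - Real.pi) / 2 +
        if t < k then Real.pi else 0) : ℝ) : ℂ) * I := by
    rw [viewLog_symm (D.norm_pt k) (D.norm_pt t).le (D.pt_injective.ne ht), ← D.im_viewLog_pt ht,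
      ← sub_conj]
    ring
  rw [key i hi, key j hj]
  push_cast
  ring

/-- For an arc the increment is the logarithm defined on the whole disc. At the boundary points it
differs from the required one by a constant, because by `hij` they all see `i` and `j` in the same
order relation. -/
lemma IsPotential.add_arc {K : Set ℂ} {s : ℂ} {F : ℂ → ℂ} {i j : Fin (2 * N)}
    (hF : IsPotential D K s (D.pt i) F) (hK : ∀ z ∈ K, ‖z‖ ≤ 1) (hi : D.pt i ∉ K)
    (hj : D.pt j ∉ K)
    (hij : ∃ C : ℝ, ∀ k, k ≠ i → k ≠ j →
      ((if j < k then Real.pi else 0) - if i < k then Real.pi else 0) = C) :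
    IsPotential D K s (D.pt j) fun z => F z + (viewLog (D.pt j) z - viewLog (D.pt i) z) := by
  obtain ⟨h1, ⟨c, h2⟩, C, h3⟩ := hF
  obtain ⟨C', hC'⟩ := hij
  have hne {t : Fin (2 * N)} (ht : D.pt t ∉ K) : ∀ z ∈ K, z ≠ D.pt t := fun z hz h => ht (h ▸ hz)
  refine ⟨h1.add ((continuousOn_viewLog (D.norm_pt j) hK hj).sub
    (continuousOn_viewLog (D.norm_pt i) hK hi)),
    ⟨c * (conj (D.pt j) / conj (D.pt i)), fun z hz => ?_⟩,
    C - ((D.angle j - D.angle i + 2 * C' : ℝ) : ℂ) * I, fun k hk => ?_⟩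
  · have hi0 := sub_ne_zero.2 (hne hi z hz).symm
    rw [Complex.exp_add, h2 z hz, exp_viewLog_sub (D.norm_pt i) (D.norm_pt j) (hK z hz)
      (hne hi z hz) (hne hj z hz)]
    calc _ = c * (conj (D.pt j) / conj (D.pt i)) *
          (((D.pt j - z) * (D.pt i - z)) / ((s - z) * (D.pt i - z))) := by
            rw [mul_mul_mul_comm, div_mul_div_comm, mul_comm (D.pt i - z)]
      _ = _ := by rw [mul_div_mul_right _ _ hi0]
  · have hki : k ≠ i := fun h => hi (h ▸ hk)
    have hkj : k ≠ j := fun h => hj (h ▸ hk)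
    beta_reduce
    rw [h3 k hk, viewLog_sub_viewLog_pt hki.symm hkj.symm, hC' k hki hkj]
    ring

/-- The union of the pieces of chords with ends in `Y` and of the vertices in `Y`. -/
def trace (D : ChordDiagram N) (P : Finset ℂ) (Y : Set ℂ) : Set ℂ :=
  {z | (z ∈ Y ∧ z ∈ D.vertices P) ∨
    ∃ u ∈ Y, ∃ v ∈ Y, D.Consecutive P u v ∧ z ∈ segment ℝ u v}

lemma norm_le_one_of_mem_vertices (hP : D.IsInterior P) {z : ℂ} (hz : z ∈ D.vertices P) :
    ‖z‖ ≤ 1 := by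
  rcases hz with ⟨i, rfl⟩ | hz
  · exact (D.norm_pt i).le
  · obtain ⟨i, hi⟩ := hP.1 z hz
    exact norm_le_one_of_mem_chord (openSegment_subset_segment _ _ _ hi)

lemma norm_le_one_of_mem_trace (hP : D.IsInterior P) {Y : Set ℂ} {z : ℂ}
    (hz : z ∈ D.trace P Y) : ‖z‖ ≤ 1 := by
  rcases hz with ⟨-, hz⟩ | ⟨u, -, v, -, ⟨-, -, -, ⟨i, hu, hv⟩, -⟩, hz⟩
  · exact norm_le_one_of_mem_vertices hP hz
  · exact norm_le_one_of_mem_chord (i := i) ((convex_segment _ _).segment_subset hu hv hz)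

lemma mem_of_mem_trace {Y : Set ℂ} {z : ℂ} (hz : z ∈ D.trace P Y) (hV : z ∈ D.vertices P) :
    z ∈ Y := by
  rcases hz with ⟨hz, -⟩ | ⟨u, hu, v, hv, h, hz⟩
  · exact hz
  · rcases h.eq_or_eq hV hz with rfl | rfl <;> assumption

lemma Consecutive.disjoint_trace (hP : D.IsInterior P) {X Y : Set ℂ} (hXY : Disjoint X Y)
    {u v : ℂ} (h : D.Consecutive P u v) (hu : u ∈ X) (hv : v ∈ X) :
    Disjoint (segment ℝ u v) (D.trace P Y) := by
  rw [Set.disjoint_left]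
  have hne : ∀ a ∈ X, ∀ b ∈ Y, a ≠ b := fun a ha b hb hab => Set.disjoint_left.1 hXY ha (hab ▸ hb)
  rintro z hz (⟨hzY, hzV⟩ | ⟨x, hx, y, hy, h', hz'⟩)
  · rcases h.eq_or_eq hzV hz with rfl | rfl
    · exact hne _ hu _ hzY rfl
    · exact hne _ hv _ hzY rfl
  · exact Set.disjoint_left.1 (h.disjoint hP h' (hne _ hu _ hx) (hne _ hu _ hy) (hne _ hv _ hx)
      (hne _ hv _ hy)) hz hz'

/-- A step along an edge of the plane graph whose ends lie in `X`. -/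
def Step (D : ChordDiagram N) (P : Finset ℂ) (X : Set ℂ) (u v : ℂ) : Prop :=
  u ∈ X ∧ v ∈ X ∧ (D.Consecutive P u v ∨ ∃ i, s(u, v) = s(D.pt i, D.pt (finRotate (2 * N) i)))

/-- The potential is the sum of the increments along the walk; disjointness of `X` and `Y` keeps
every step away from the trace of `Y`. -/
lemma exists_potential (hP : D.IsInterior P) {X Y : Set ℂ} (hXY : Disjoint X Y)
    {s x : ℂ} (hs : s ∈ X) (hsV : s ∈ D.vertices P)
    (h : Relation.ReflTransGen (D.Step P X) s x) :
    ∃ F, IsPotential D (D.trace P Y) s x F := by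
  have hXt {a : ℂ} (ha : a ∈ X) (haV : a ∈ D.vertices P) : a ∉ D.trace P Y :=
    fun h => Set.disjoint_left.1 hXY ha (mem_of_mem_trace h haV)
  have hK : ∀ z ∈ D.trace P Y, ‖z‖ ≤ 1 := fun z hz => norm_le_one_of_mem_trace hP hz
  induction h with
  | refl => exact ⟨_, isPotential_refl (hXt hs hsV)⟩
  | @tail u v _ huv ih =>
    obtain ⟨F, hF⟩ := ih
    obtain ⟨hu, hv, huv | ⟨i, hi⟩⟩ := huv
    · exact ⟨_, hF.add_segment (norm_le_one_of_mem_vertices hP huv.2.1)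
        (norm_le_one_of_mem_vertices hP huv.2.2.1) (huv.disjoint_trace hP hXY hu hv)⟩
    · have hpt (i) : D.pt i ∈ D.vertices P := Or.inl ⟨i, rfl⟩
      rcases Sym2.eq_iff.1 hi with ⟨rfl, rfl⟩ | ⟨rfl, rfl⟩
      · exact ⟨_, hF.add_arc hK (hXt hu (hpt _)) (hXt hv (hpt _)) (exists_if_rotate_sub i)⟩
      · refine ⟨_, hF.add_arc hK (hXt hu (hpt _)) (hXt hv (hpt _)) ?_⟩
        obtain ⟨C, hC⟩ := exists_if_rotate_sub i
        exact ⟨-C, fun k h1 h2 => by rw [← hC k h2 h1]; ring⟩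

/-- The ends of a walk that avoids a walk from the `a`-th to the `b`-th boundary point lie on the
same side of the latter. -/
lemma if_sub_if_eq_of_disjoint (hP : D.IsInterior P) {X Y : Set ℂ} (hXY : Disjoint X Y)
    {a b k l : Fin (2 * N)} (hab : Relation.ReflTransGen (D.Step P X) (D.pt a) (D.pt b))
    (haX : D.pt a ∈ X) (hbX : D.pt b ∈ X)
    (hkl : Relation.ReflTransGen (D.Step P Y) (D.pt k) (D.pt l)) (hkY : D.pt k ∈ Y)
    (hlY : D.pt l ∈ Y) :
    ((if b < k then Real.pi else 0) - if a < k then Real.pi else 0) =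
      ((if b < l then Real.pi else 0) - if a < l then Real.pi else 0) := by
  have hpt (i) : D.pt i ∈ D.vertices P := Or.inl ⟨i, rfl⟩
  obtain ⟨F, hF, ⟨c, hc⟩, C, hC⟩ := exists_potential hP hXY haX (hpt a) hab
  have hXt {i} (hi : D.pt i ∈ X) : D.pt i ∉ D.trace P Y :=
    fun h => Set.disjoint_left.1 hXY hi (mem_of_mem_trace h (hpt i))
  have hneY {i j} (hi : D.pt i ∈ X) (hj : D.pt j ∈ Y) : i ≠ j :=
    fun h => Set.disjoint_left.1 hXY hi (h ▸ hj)
  have hK : ∀ z ∈ D.trace P Y, ‖z‖ ≤ 1 := fun z hz => norm_le_one_of_mem_trace hP hz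
  have hmemY {i} (hi : D.pt i ∈ Y) : D.pt i ∈ D.trace P Y := Or.inl ⟨hi, hpt i⟩
  -- Both terms are logarithms of constant multiples of `(b - z) / (a - z)`, so `exp ∘ H` is
  -- constant on the trace.
  set H : ℂ → ℂ := fun z => F z - (viewLog (D.pt b) z - viewLog (D.pt a) z) with hH
  have hHcont : ContinuousOn H (D.trace P Y) :=
    hF.sub ((continuousOn_viewLog (D.norm_pt b) hK (hXt hbX)).sub
      (continuousOn_viewLog (D.norm_pt a) hK (hXt haX)))
  have hHexp : ∀ z ∈ D.trace P Y, exp (H z) = c / (conj (D.pt b) / conj (D.pt a)) := by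
    intro z hz
    have hza : z ≠ D.pt a := fun h => hXt haX (h ▸ hz)
    have hzb : z ≠ D.pt b := fun h => hXt hbX (h ▸ hz)
    have hq : (D.pt b - z) / (D.pt a - z) ≠ 0 :=
      div_ne_zero (sub_ne_zero.2 hzb.symm) (sub_ne_zero.2 hza.symm)
    rw [hH]
    simp only
    rw [Complex.exp_sub, hc z hz, exp_viewLog_sub (D.norm_pt a) (D.norm_pt b) (hK z hz) hza hzb,
      mul_div_mul_right _ _ hq]
  have hHpt {i} (hi : D.pt i ∈ Y) : H (D.pt i) = C +
      (((D.angle b - D.angle a) + 2 * ((if b < i then Real.pi else 0) -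
          if a < i then Real.pi else 0) : ℝ) : ℂ) * I := by
    rw [hH]
    simp only
    rw [hC i (hmemY hi), viewLog_sub_viewLog_pt (hneY haX hi) (hneY hbX hi)]
    ring
  -- On a piece of a chord `H` is constant by continuity. Arcs are not in the trace; there the
  -- explicit boundary values agree, as neither `a` nor `b` is an end of the arc.
  have hconst : ∀ y, Relation.ReflTransGen (D.Step P Y) (D.pt k) y → H y = H (D.pt k) := by
    intro y hy
    induction hy with
    | refl => rfl
    | @tail u v _ huv ih =>
      rw [← ih]
      obtain ⟨hu, hv, huv | ⟨i, hi⟩⟩ := huv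
      · have hsub : segment ℝ u v ⊆ D.trace P Y := fun z hz => Or.inr ⟨u, hu, v, hv, huv, hz⟩
        exact eq_of_exp_eq_const (convex_segment u v).isPreconnected (hHcont.mono hsub)
          (fun z hz => hHexp z (hsub hz)) (right_mem_segment ℝ u v) (left_mem_segment ℝ u v)
      · rcases Sym2.eq_iff.1 hi with ⟨rfl, rfl⟩ | ⟨rfl, rfl⟩
        · rw [hHpt hu, hHpt hv, if_sub_if_rotate (hneY haX hu) (hneY haX hv) (hneY hbX hu)
            (hneY hbX hv)]
        · rw [hHpt hu, hHpt hv, if_sub_if_rotate (hneY haX hv) (hneY haX hu) (hneY hbX hv)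
            (hneY hbX hu)]
  have h := hconst _ hkl
  rw [hHpt hkY, hHpt hlY, add_right_inj, mul_left_inj' I_ne_zero, ofReal_inj] at h
  linarith

/-- Walks in the plane graph with interleaved ends on the circle have a common vertex. -/
theorem joined_of_interleaved (hP : D.IsInterior P) {E : Set (Sym2 ℂ ⊕ Fin (2 * N))}
    {a b k l : Fin (2 * N)} (hak : a < k) (hkb : k < b) (hbl : b < l)
    (hab : Joined (D.planeGraph P S) E (D.pt a) (D.pt b))
    (hkl : Joined (D.planeGraph P S) E (D.pt k) (D.pt l)) :
    Joined (D.planeGraph P S) E (D.pt a) (D.pt k) := by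
  by_contra hak'
  set G := D.planeGraph P S
  have hstep {x : ℂ} : ∀ y, Joined G E x y →
      Relation.ReflTransGen (D.Step P {z | Joined G E x z}) x y := by
    intro y hy
    induction hy with
    | refl => exact .refl
    | @tail u v hu huv ih =>
      refine ih.tail ⟨hu, hu.tail huv, ?_⟩
      obtain ⟨e | i, -, he⟩ := huv
      · exact Or.inl he.2
      · exact Or.inr ⟨i, he.2⟩
  have hXY : Disjoint {z | Joined G E (D.pt a) z} {z | Joined G E (D.pt k) z} := by
    rw [Set.disjoint_left]
    exact fun z hz hz' => hak' (hz.trans (Joined.symm hz'))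
  have h := if_sub_if_eq_of_disjoint hP hXY (hstep _ hab) .refl hab (hstep _ hkl) .refl hkl
  -- For `a < k < b < l` the two sides are `-π` and `0`.
  rw [if_neg hkb.not_gt, if_pos hak, if_pos hbl, if_pos (hak.trans (hkb.trans hbl))] at h
  have := Real.pi_pos
  linarith

end ChordDiagram
end ChordTNNP
end

noncomputable section

namespace ChordTNNP
namespace ChordDiagram

open Complex ComplexConjugate

variable {N : ℕ} {D : ChordDiagram N} {P : Finset ℂ} {S : Set (Fin (2 * N))}

/-! ### Intersection points -/

/-- The equation of the line through two points of the unit circle; it makes the intersection of two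
chords a linear problem in `z` and `conj z`. -/
lemma add_mul_conj_eq {u v z : ℂ} (hu : ‖u‖ = 1) (hv : ‖v‖ = 1) (hz : z ∈ segment ℝ u v) :
    z + u * v * conj z = u + v := by
  obtain ⟨a, b, -, -, hab, rfl⟩ := hz
  have h1 : u * conj u = 1 := by rw [mul_conj', hu]; simp
  have h2 : v * conj v = 1 := by rw [mul_conj', hv]; simp
  have h3 : (a : ℂ) + b = 1 := by exact_mod_cast hab
  simp only [real_smul, map_add, map_mul, conj_ofReal]
  linear_combination (a * v) * h1 + (b * u) * h2 + (u + v) * h3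

lemma chord_inter_subsingleton {i j : Fin (2 * N)} (h1 : j ≠ i) (h2 : j ≠ D.mate i) :
    (D.chord i ∩ D.chord j).Subsingleton := by
  rintro z ⟨hzi, hzj⟩ w ⟨hwi, hwj⟩
  have ei := add_mul_conj_eq (D.norm_pt _) (D.norm_pt _) hzi
  have ej := add_mul_conj_eq (D.norm_pt _) (D.norm_pt _) hzj
  have fi := add_mul_conj_eq (D.norm_pt _) (D.norm_pt _) hwi
  have fj := add_mul_conj_eq (D.norm_pt _) (D.norm_pt _) hwj
  -- Equal products force equal sums of the ends, since the chords meet; then both pairs of ends are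
  -- the roots of one quadratic polynomial.
  by_cases hprod : D.pt i * D.pt (D.mate i) = D.pt j * D.pt (D.mate j)
  · exfalso
    have hsum : D.pt i + D.pt (D.mate i) = D.pt j + D.pt (D.mate j) := by
      rw [← ei, ← ej, hprod]
    have : (D.pt j - D.pt i) * (D.pt j - D.pt (D.mate i)) = 0 := by
      linear_combination hprod - D.pt j * hsum
    rcases mul_eq_zero.1 this with h | h
    · exact h1 (D.pt_injective (sub_eq_zero.1 h))
    · exact h2 (D.pt_injective (sub_eq_zero.1 h))
  · have : conj z = conj w := by
      refine mul_left_cancel₀ (sub_ne_zero.2 hprod) ?_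
      linear_combination ei - ej - fi + fj
    exact RingHom.injective _ this

lemma crossings_finite : D.crossings.Finite := by
  refine Set.Finite.subset (s := ⋃ i, ⋃ j, {z | (j ≠ i ∧ j ≠ D.mate i) ∧ z ∈ D.chord i ∩ D.chord j})
    (Set.finite_iUnion fun i => Set.finite_iUnion fun j => Set.Subsingleton.finite ?_) ?_
  · rintro z ⟨h, hz⟩ w ⟨-, hw⟩
    exact chord_inter_subsingleton h.1 h.2 hz hw
  · rintro z ⟨i, j, h1, h2, hi, hj⟩
    exact Set.mem_iUnion.2 ⟨i, Set.mem_iUnion.2 ⟨j, ⟨h1, h2⟩, hi, hj⟩⟩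

lemma norm_lt_one_of_mem_openChord {i : Fin (2 * N)} {z : ℂ} (hz : z ∈ D.openChord i) :
    ‖z‖ < 1 := by
  have h := openSegment_subset_ball_of_ne (x := D.pt i) (y := D.pt (D.mate i)) (z := (0 : ℂ))
    (r := 1) (by simp [norm_pt]) (by simp [norm_pt])
    (fun h => D.mate_ne i (D.pt_injective h).symm) hz
  simpa using h

lemma eq_or_eq_of_pt_mem_chord {i j : Fin (2 * N)} (h : D.pt i ∈ D.chord j) :
    i = j ∨ i = D.mate j := by
  rw [chord, ← insert_endpoints_openSegment] at h
  rcases h with h | h | h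
  · exact Or.inl (D.pt_injective h)
  · exact Or.inr (D.pt_injective h)
  · have := norm_lt_one_of_mem_openChord (D := D) (i := j) h
    rw [norm_pt] at this
    exact absurd this (lt_irrefl _)

lemma crossings_subset_iUnion_openChord : D.crossings ⊆ ⋃ i, D.openChord i := by
  rintro z ⟨i, j, h1, h2, hi, hj⟩
  have hi' := hi
  rw [chord, ← insert_endpoints_openSegment] at hi'
  rcases hi' with rfl | rfl | h
  · rcases eq_or_eq_of_pt_mem_chord hj with h | h
    · exact absurd h.symm h1
    · exact absurd (by rw [h, D.mate_mate]) h2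
  · rcases eq_or_eq_of_pt_mem_chord hj with h | h
    · exact absurd h.symm h2
    · exact absurd (by rw [← D.mate_mate i, h, D.mate_mate]) h1
  · exact Set.mem_iUnion.2 ⟨i, h⟩

lemma openChord_infinite (i : Fin (2 * N)) : (D.openChord i).Infinite := by
  have hne : D.pt i ≠ D.pt (D.mate i) := fun h => D.mate_ne i (D.pt_injective h).symm
  rw [openChord, openSegment_eq_image_lineMap]
  exact (Set.Ioo_infinite zero_lt_one).image (AffineMap.lineMap_injective ℝ hne).injOn

/-- There are admissible sets of interior points with any prescribed number of elements that is
not less than the number of intersection points. -/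
lemma exists_isInterior_card_eq (hN : 0 < N) (D : ChordDiagram N) {k : ℕ}
    (hk : D.crossings.ncard ≤ k) : ∃ P : Finset ℂ, D.IsInterior P ∧ P.card = k := by
  have hinf : (⋃ i, D.openChord i).Infinite :=
    (openChord_infinite ⟨0, by omega⟩).mono (Set.subset_iUnion _ _)
  -- Separate because `ncard` is also `0` for infinite sets: a superset with `ncard` equal to `0`
  -- need not be finite.
  by_cases hk0 : k = 0
  · subst hk0
    have : D.crossings = ∅ := (Set.ncard_eq_zero crossings_finite).1 (Nat.le_zero.1 hk)
    exact ⟨∅, ⟨by simp, by simp [this]⟩, rfl⟩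
  · obtain ⟨Q, h1, h2, h3⟩ := hinf.exists_superset_ncard_eq crossings_subset_iUnion_openChord
      crossings_finite hk
    have hQ : Q.Finite := Set.finite_of_ncard_ne_zero (h3 ▸ hk0)
    refine ⟨hQ.toFinset, ⟨fun z hz => ?_, ?_⟩, ?_⟩
    · exact Set.mem_iUnion.1 (h2 (hQ.mem_toFinset.1 hz))
    · rwa [hQ.coe_toFinset]
    · rw [← h3, Set.ncard_eq_toFinset_card _ hQ]

/-! ### The plane graph -/

lemma vertexSet_finite : (D.planeGraph P S).vertexSet.Finite :=
  (Set.finite_range _).union P.finite_toSet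

lemma edgeSet_finite : (D.planeGraph P S).edgeSet.Finite := by
  have hV : (D.vertices P).Finite := vertexSet_finite (S := S)
  refine (((hV.prod hV).image fun p => Sum.inl s(p.1, p.2)).union
    (Set.finite_range Sum.inr)).subset ?_
  rintro (e | i) he
  · obtain ⟨u, v, rfl, h⟩ := (Graph.edge_mem_iff_exists_isLink _ _).1 he
    exact Or.inl ⟨(u, v), ⟨h.2.1, h.2.2.1⟩, rfl⟩
  · exact Or.inr ⟨i, rfl⟩

lemma not_isLink_self (e : Sym2 ℂ ⊕ Fin (2 * N)) (v : ℂ) : ¬ (D.planeGraph P S).IsLink e v v := by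
  rcases e with e | i
  · exact fun h => h.2.1 rfl
  · rintro ⟨-, h⟩
    have hi : D.pt i = D.pt (finRotate (2 * N) i) := by
      rcases Sym2.eq_iff.1 h with h | h
      · exact h.1.symm.trans h.2
      · exact h.2.symm.trans h.1
    have := D.pt_injective hi
    have hmem : i ∈ Equiv.Perm.support (finRotate (2 * N)) := by
      rw [support_finRotate_of_le (by have := i.2; omega)]
      exact Finset.mem_univ i
    exact Equiv.Perm.mem_support.1 hmem this.symm

lemma transpose_matchingMatrix : (D.matchingMatrix P S).transpose = -D.matchingMatrix P S := by
  ext i j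
  simp only [matchingMatrix, Matrix.transpose_apply, Matrix.neg_apply, Matrix.of_apply]
  rcases lt_trichotomy i j with h | rfl | h
  · rw [if_neg h.not_gt, if_pos h, if_pos h, Set.pair_comm]
  · simp
  · rw [if_pos h, if_neg h.not_gt, if_pos h, Set.pair_comm, neg_neg]

lemma matchingMatrix_of_lt {i j : Fin (2 * N)} (h : i < j) :
    D.matchingMatrix P S i j =
      (matchingCount ((D.planeGraph P S).deleteVerts {D.pt i, D.pt j}) : ℝ) := if_pos h

/-- The expansion of `M(G) M(G \ T)` for a set `T` of boundary points, along the first of them. -/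
lemma matchingCount_mul_matchingCount (hP : D.IsInterior P) {n : ℕ}
    (f : Fin (n + 1) ↪o Fin (2 * N)) :
    (matchingCount (D.planeGraph P S) : ℝ) *
        matchingCount ((D.planeGraph P S).deleteVerts (Set.range (D.pt ∘ f))) =
      ∑ j : Fin n, (-1) ^ (j : ℕ) *
        ((matchingCount ((D.planeGraph P S).deleteVerts {D.pt (f 0), D.pt (f j.succ)}) : ℝ) *
          matchingCount ((D.planeGraph P S).deleteVerts ((D.pt ∘ f) '' {0, j.succ}ᶜ))) := by
  have h := sum_matchingCount_mul_eq_zero (G := D.planeGraph P S) (b := D.pt ∘ f)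
    vertexSet_finite edgeSet_finite not_isLink_self (D.pt_injective.comp f.injective)
    (fun i => Or.inl ⟨_, rfl⟩) (fun E i j k l hij hjk hkl h1 h2 => joined_of_interleaved hP
      (f.lt_iff_lt.2 hij) (f.lt_iff_lt.2 hjk) (f.lt_iff_lt.2 hkl) h1 h2) {0}
  have hsymm (j : Fin n) : symmDiff {0} {j.succ} = ({0, j.succ} : Set (Fin (n + 1))) := by
    ext i
    simp only [Set.mem_symmDiff, Set.mem_singleton_iff, Set.mem_insert_iff]
    have : (0 : Fin (n + 1)) ≠ j.succ := (Fin.succ_ne_zero j).symm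
    grind
  -- With `X = {0}` the term of index `0` is `M(G) * M(G \ T)`; the shift of the other indices by
  -- one supplies the minus sign that moves them across.
  rw [Fin.sum_univ_succ] at h
  simp only [symmDiff_self, Set.bot_eq_empty, Set.image_empty, Graph.deleteVerts_empty,
    Set.compl_empty, Set.image_univ, Fin.val_zero, pow_zero, one_mul, hsymm, Fin.val_succ,
    pow_succ, mul_neg, mul_one, neg_mul, Finset.sum_neg_distrib, Set.image_pair,
    Function.comp_apply] at h
  exact add_neg_eq_zero.1 h

lemma range_comp_skipPair {m : ℕ} {β : Type*} (g : Fin (2 * (m + 1)) → β) (j : Fin (2 * m + 1)) :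
    Set.range (g ∘ skipPair j) = g '' {⟨0, by omega⟩, j.succ}ᶜ := by
  rw [Set.range_comp]
  congr 1
  ext i
  constructor
  · rintro ⟨x, rfl⟩ (h | h)
    · exact Fin.succ_ne_zero _ h
    · exact Fin.succAbove_ne j x (Fin.succ_injective _ h)
  · intro h
    obtain ⟨k, rfl⟩ := Fin.exists_succ_eq.2 fun h0 => h (Or.inl h0)
    obtain ⟨x, hx⟩ := Fin.exists_succAbove_eq (x := k) (y := j) fun hk => h (Or.inr (hk ▸ rfl))
    exact ⟨x, congrArg Fin.succ hx⟩

/-- The Pfaffian of a non-empty principal submatrix of the matching matrix is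
`M(G) ^ m * M(G \ T)`, where `T` is the set of the corresponding `2 (m + 1)` boundary points. -/
theorem pfaffian_matchingMatrix (hP : D.IsInterior P) (m : ℕ)
    (f : Fin (2 * (m + 1)) ↪o Fin (2 * N)) :
    pfaffian ((D.matchingMatrix P S).submatrix f f) =
      (matchingCount (D.planeGraph P S) : ℝ) ^ m *
        matchingCount ((D.planeGraph P S).deleteVerts (Set.range (D.pt ∘ f))) := by
  have hentry {m : ℕ} (f : Fin (2 * (m + 1)) ↪o Fin (2 * N)) (j : Fin (2 * m + 1)) :
      (D.matchingMatrix P S).submatrix f f ⟨0, by omega⟩ j.succ =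
        matchingCount ((D.planeGraph P S).deleteVerts {D.pt (f ⟨0, by omega⟩), D.pt (f j.succ)}) :=
    matchingMatrix_of_lt (f.lt_iff_lt.2 (Fin.succ_pos j))
  induction m with
  | zero =>
    rw [pfaffian_succ]
    simp only [hentry, pfaffian_zero]
    have hr : Set.range (D.pt ∘ f) = {D.pt (f ⟨0, by omega⟩), D.pt (f ⟨1, by omega⟩)} := by
      ext z
      constructor
      · rintro ⟨i, rfl⟩
        fin_cases i
        · exact Or.inl rfl
        · exact Or.inr rfl
      · rintro (rfl | rfl) <;> exact ⟨_, rfl⟩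
    rw [hr, pow_zero, one_mul]
    refine (Fin.sum_univ_one _).trans ?_
    simp
  | succ m ih =>
    -- One factor `M(G)` is used up by the condensation identity; the remaining power belongs to the
    -- smaller Pfaffians.
    rw [pfaffian_succ, pow_succ, mul_assoc,
      matchingCount_mul_matchingCount (n := 2 * (m + 1) + 1) hP f, Finset.mul_sum]
    refine Finset.sum_congr rfl fun j _ => ?_
    rw [hentry, Matrix.submatrix_submatrix]
    have := ih ((skipPair j).trans f)
    rw [RelEmbedding.coe_trans, ← Function.comp_assoc, range_comp_skipPair] at this
    rw [this]
    exact (by intros; ring : ∀ s p x y : ℝ, s * x * (p * y) = p * (s * (x * y))) _ _ _ _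

/-- The matching matrix of a chord diagram is a totally non-negative Pfaffian. -/
theorem isTNNP_matchingMatrix (hP : D.IsInterior P) : IsTNNP (D.matchingMatrix P S) where
  skew := transpose_matchingMatrix
  nonneg m f := by
    cases m with
    | zero => rw [pfaffian_zero]; exact zero_le_one
    | succ m => rw [pfaffian_matchingMatrix hP m f]; positivity

end ChordDiagram
end ChordTNNP
end

theorem theorem2p6 (N : ℕ) (hN : 0 < N) (D : ChordTNNP.ChordDiagram N) :
    (∃ P : Finset ℂ, D.IsInterior P ∧ Even P.card ∧
      P.card = D.crossings.ncard +
        (if D.crossings.ncard = 0 then 2 else D.crossings.ncard % 2)) ∧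
    ∀ P : Finset ℂ, D.IsInterior P → Even P.card → ∀ S : Set (Fin (2 * N)),
      ChordTNNP.IsTNNP (D.matchingMatrix P S) := by
  refine ⟨?_, fun P hP _ S => ChordTNNP.ChordDiagram.isTNNP_matchingMatrix hP⟩
  obtain ⟨P, hP, hcard⟩ := ChordTNNP.ChordDiagram.exists_isInterior_card_eq hN D
    (Nat.le_add_right D.crossings.ncard
      (if D.crossings.ncard = 0 then 2 else D.crossings.ncard % 2))
  refine ⟨P, hP, ?_, hcard⟩
  rw [hcard, Nat.even_iff]
  split_ifs <;> omega
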